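/- Let $d>0$ and $\Omega=\mathbb R\times(0,d)$. For $n\in\mathbb N^*=\{1,2,\dots\}$ and $y\in(0,d)$ put $$\chi_n^-(y)=\sqrt{\tfrac2d}\,\sin\Big((2n-1)\frac{\pi y}{2d}\Big),\qquad \chi_n^+(y)=\sqrt{\tfrac2d}\,\cos\Big((2n-1)\frac{\pi y}{2d}\Big),\qquad \mu_n=(2n-1)^2\frac{\pi^2}{4d^2}.$$ Let $n_0\in\mathbb N^*$, $k>0$ and $E=\mu_{n_0}+k^2$, and assume that $E\ne\mu_n$ for every $n\in\mathbb N^*$. Let $n_1=\Big\lfloor \tfrac12+\sqrt{(n_0-\tfrac12)^2+\tfrac{d^2}{\pi^2}k^2}\Big\rfloor$, $k_n=\sqrt{\mu_{n_0}-\mu_n+k^2}$ for $1\le n\le n_1$, and $\kappa_n=\sqrt{\mu_n-\mu_{n_0}-k^2}$ for $n\ge n_1+1$. Let $p_n^\pm=(\chi_n^\pm,\cdot)_{L^2(0,d)}\chi_n^\pm$, let $$\mathcal H^{1/2}_\pm=\Big\{g=\sum_{n\ge1}c_n\chi_n^\pm\in L^2(0,d)\ \Big|\ \sum_{n\ge1}n|c_n|^2<\infty\Big\},\qquad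 \mathcal H^{1/2}=\mathcal H^{1/2}_-\cap\mathcal H^{1/2}_+,\qquad \mathcal H^{-1/2}=(\mathcal H^{1/2})',$$ and let $D:\mathcal H^{1/2}\to\mathcal H^{-1/2}$ be the operator $$D=-i\sum_{l=1}^{n_1}k_l(p_l^-+p_l^+)+\sum_{n=n_1+1}^\infty\kappa_n(p_n^-+p_n^+),$$ where a series $\sum_n c_n\chi_n^\pm$ acts on $\psi\in\mathcal H^{1/2}$ by $\sum_n\overline{c_n}\,(\chi_n^\pm,\psi)_{L^2(0,d)}$. Then there exist a function $f$ on $\Omega$ and complex coefficients $(r_n)_{n\ge1}$, $(t_n)_{n\ge1}$ with $$\sum_{n\ge1}n|r_n|^2<\infty,\qquad \sum_{n\ge1}n|t_n|^2<\infty,$$ such that, for all $y\in(0,d)$, $$f(x,y)=e^{ikx}\chi^-_{n_0}(y)+\sum_{l=1}^{n_1}r_l e^{-ik_lx}\chi_l^-(y)+\sum_{n=n_1+1}^\infty r_n e^{\kappa_n x}\chi_n^-(y)\quad(x<0),$$ $$f(x,y)=\sum_{l=1}^{n_1}t_l e^{ik_lx}\chi_l^+(y)+\sum_{n=n_1+1}^\infty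 t_n e^{-\kappa_n x}\chi_n^+(y)\quad(x>0),$$ and such that $f$ is locally integrable in $\Omega$ and satisfies $(\Delta+E)f=0$ in the sense of distributions in $\Omega$. Moreover, the one-sided limits of $f(x,\cdot)$ in $L^2(0,d)$ as $x\to0^-$ and as $x\to0^+$ exist and are equal to one function $\varphi\in\mathcal H^{1/2}$, which satisfies $$D\varphi=-2ik\,\chi_{n_0}^-\quad\text{in }\mathcal H^{-1/2}.$$ -/

import Mathlib

open MeasureTheory Filter Topology Set
open scoped ENNReal ContDiff ComplexConjugate

noncomputable section

namespace Waveguide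

/-- The waveguide (strip) `ℝ × (0,d)`. -/
def strip (d : ℝ) : Set (ℝ × ℝ) := univ ×ˢ Ioo 0 d

/-- Lebesgue measure on the cross-section `(0,d)`. -/
def crossMeasure (d : ℝ) : Measure ℝ := volume.restrict (Ioo 0 d)

/-- Left transversal mode `χ⁻_n` (Dirichlet at `y = 0`, Neumann at `y = d`), for `n ≥ 1`. -/
def chiMinus (d : ℝ) (n : ℕ) (y : ℝ) : ℝ :=
  Real.sqrt (2 / d) * Real.sin ((2 * (n : ℝ) - 1) * (Real.pi * y / (2 * d)))

/-- Right transversal mode `χ⁺_n` (Neumann at `y = 0`, Dirichlet at `y = d`), for `n ≥ 1`. -/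
def chiPlus (d : ℝ) (n : ℕ) (y : ℝ) : ℝ :=
  Real.sqrt (2 / d) * Real.cos ((2 * (n : ℝ) - 1) * (Real.pi * y / (2 * d)))

/-- Transversal eigenvalue `μ_n`, for `n ≥ 1`. -/
def mu (d : ℝ) (n : ℕ) : ℝ := (2 * (n : ℝ) - 1) ^ 2 * (Real.pi ^ 2 / (4 * d ^ 2))

/-- Index `n₁` of the highest excitable transversal mode. -/
def topMode (d : ℝ) (n₀ : ℕ) (k : ℝ) : ℕ :=
  ⌊1 / 2 + Real.sqrt (((n₀ : ℝ) - 1 / 2) ^ 2 + d ^ 2 / Real.pi ^ 2 * k ^ 2)⌋₊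

/-- Longitudinal momentum `k_n`, used for `1 ≤ n ≤ n₁`. -/
def kMode (d : ℝ) (n₀ : ℕ) (k : ℝ) (n : ℕ) : ℝ :=
  Real.sqrt (mu d n₀ - mu d n + k ^ 2)

/-- Decay rate `κ_n`, used for `n ≥ n₁ + 1`. -/
def kappaMode (d : ℝ) (n₀ : ℕ) (k : ℝ) (n : ℕ) : ℝ :=
  Real.sqrt (mu d n - mu d n₀ - k ^ 2)

/-- `f` has the mode expansion with reflection coefficients `r n` and transmission coefficients
`t n`, `n ≥ 1`: incident wave in mode `n₀` plus reflected and evanescent modes for `x < 0`,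
transmitted and evanescent modes for `x > 0`. The values at the index `0` play no role. -/
structure HasModeExpansion (d : ℝ) (n₀ : ℕ) (k : ℝ) (r t : ℕ → ℂ) (f : ℝ → ℝ → ℂ) : Prop where
  left : ∀ x : ℝ, x < 0 → ∀ y ∈ Ioo 0 d,
    HasSum
      (fun j : ℕ =>
        r (topMode d n₀ k + 1 + j) *
          Complex.exp ((kappaMode d n₀ k (topMode d n₀ k + 1 + j) : ℂ) * (x : ℂ)) *
          (chiMinus d (topMode d n₀ k + 1 + j) y : ℂ))
      (f x y -
        (Complex.exp (Complex.I * (k : ℂ) * (x : ℂ)) * (chiMinus d n₀ y : ℂ) +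
          ∑ l ∈ Finset.Icc 1 (topMode d n₀ k),
            r l * Complex.exp (-Complex.I * (kMode d n₀ k l : ℂ) * (x : ℂ)) *
              (chiMinus d l y : ℂ)))
  right : ∀ x : ℝ, 0 < x → ∀ y ∈ Ioo 0 d,
    HasSum
      (fun j : ℕ =>
        t (topMode d n₀ k + 1 + j) *
          Complex.exp (-(kappaMode d n₀ k (topMode d n₀ k + 1 + j) : ℂ) * (x : ℂ)) *
          (chiPlus d (topMode d n₀ k + 1 + j) y : ℂ))
      (f x y -
        ∑ l ∈ Finset.Icc 1 (topMode d n₀ k),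
          t l * Complex.exp (Complex.I * (kMode d n₀ k l : ℂ) * (x : ℂ)) *
            (chiPlus d l y : ℂ))

/-- Classical Laplacian `∂²/∂x² + ∂²/∂y²` of a (smooth) function on the plane. -/
def lap (v : ℝ × ℝ → ℂ) (p : ℝ × ℝ) : ℂ :=
  iteratedDeriv 2 (fun s : ℝ => v (s, p.2)) p.1 + iteratedDeriv 2 (fun s : ℝ => v (p.1, s)) p.2

/-- `(Δ + E) f = 0` in the sense of distributions in the strip. -/
def IsDistribSolution (d E : ℝ) (f : ℝ → ℝ → ℂ) : Prop :=
  LocallyIntegrableOn (fun p : ℝ × ℝ => f p.1 p.2) (strip d) volume ∧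
  ∀ v : ℝ × ℝ → ℂ, ContDiff ℝ ∞ v → HasCompactSupport v → tsupport v ⊆ strip d →
    ∫ p in strip d, f p.1 p.2 * (lap v p + (E : ℂ) * v p) = 0

/-- `g ∈ L²(0,d)` belongs to `𝓗^α_±` (`α ≥ 0`), for the family `χ = χ^±`:
`g = ∑_{n ≥ 1} c_n χ_n` in `L²(0,d)` with `∑_{n ≥ 1} n^{2α} |c_n|² < ∞`. -/
def MemSobolev (d : ℝ) (χ : ℕ → ℝ → ℝ) (α : ℝ) (g : ℝ → ℂ) : Prop :=
  MemLp g 2 (crossMeasure d) ∧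
  ∃ c : ℕ → ℂ,
    Tendsto
      (fun N : ℕ =>
        eLpNorm (fun y => g y - ∑ n ∈ Finset.Icc 1 N, c n * (χ n y : ℂ)) 2 (crossMeasure d))
      atTop (𝓝 0) ∧
    Summable (fun j : ℕ => ((j + 1 : ℕ) : ℝ) ^ (2 * α) * ‖c (j + 1)‖ ^ 2)

/-- The space `𝓗^{1/2} = 𝓗^{1/2}_- ∩ 𝓗^{1/2}_+`. -/
def MemHHalf (d : ℝ) (g : ℝ → ℂ) : Prop :=
  MemSobolev d (chiMinus d) (1 / 2) g ∧ MemSobolev d (chiPlus d) (1 / 2) g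

/-- The coefficient `(χ_n, g)_{L²(0,d)}`. -/
def coeff (d : ℝ) (χ : ℕ → ℝ → ℝ) (n : ℕ) (g : ℝ → ℂ) : ℂ :=
  ∫ y, (χ n y : ℂ) * g y ∂(crossMeasure d)

/-- The multiplier of `p_n^- + p_n^+` in `D`: `-i k_n` for `n ≤ n₁`, and `κ_n` for `n > n₁`. -/
def symbolD (d : ℝ) (n₀ : ℕ) (k : ℝ) (n : ℕ) : ℂ :=
  if n ≤ topMode d n₀ k then -Complex.I * (kMode d n₀ k n : ℂ) else (kappaMode d n₀ k n : ℂ)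

/-- `D φ = c χ⁻_m` in `𝓗^{-1/2} = (𝓗^{1/2})'`, where
`D = -i ∑_{l ≤ n₁} k_l (p_l^- + p_l^+) + ∑_{n > n₁} κ_n (p_n^- + p_n^+)`: both sides have the same
duality bracket (antilinear in the first argument) with every `ψ ∈ 𝓗^{1/2}`. -/
def DEqMode (d : ℝ) (n₀ : ℕ) (k : ℝ) (φ : ℝ → ℂ) (c : ℂ) (m : ℕ) : Prop :=
  ∀ ψ : ℝ → ℂ, MemHHalf d ψ →
    HasSum
      (fun j : ℕ =>
        conj (symbolD d n₀ k (j + 1) * coeff d (chiMinus d) (j + 1) φ) *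
            coeff d (chiMinus d) (j + 1) ψ +
          conj (symbolD d n₀ k (j + 1) * coeff d (chiPlus d) (j + 1) φ) *
            coeff d (chiPlus d) (j + 1) ψ)
      (conj c * coeff d (chiMinus d) m ψ)

end Waveguide

end

open Waveguide

/-! On each side of x = 0 the outgoing solutions of the Helmholtz equation are superpositions of
e^{-s_n|x|} χ_n^±, where s_n = `symbolD` is the square root of μ_n - E equal to -i k_n for
propagating modes and to κ_n for evanescent ones. A function φ with expansions in both families
therefore determines a field: t_n are its χ^+ coefficients and r_n its χ^- coefficients minus
δ_{n,n₀}. The traces at x = 0 agree by construction, and the jump of ∂_x f is formally -(Dφ + 2ik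
χ^-_{n₀}), so the interface disappears once Dφ = -2ik χ^-_{n₀}.

That equation is solved by Lax–Milgram. Every s_n lies on the nonnegative real or the negative
imaginary axis, so Re((1 - i) conj s_n) = |s_n|: after one common rotation the form of D is coercive
in the norm with weights |s_n|. Since E is not a threshold, |s_n| is comparable to n, so this is the
𝓗^{1/2} norm. The form lives on pairs of coefficient sequences, restricted to the closed subspace of
pairs that represent the same function (`exists_form_solution`, `exists_DEqMode`).

The distributional equation is checked against a test function v. Green's identity for one mode
(`integral_mode_mul_helmholtz`) leaves only terms at x = 0, and termwise integration is justified by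
decay of the modes. In `integral_scatteringField_mul_helmholtz` the terms with ∂_x v(0,·) cancel by
Parseval in both families, and the terms with v(0,·) cancel by the equation for φ. The latter needs
v(0,·) ∈ 𝓗^{1/2}, which comes from a Fourier series on a circle of length 4d
(`IsCrossTest.memHHalf`). -/

noncomputable section

namespace Waveguide

/-! ### The symbol of D -/

lemma mu_eq (d : ℝ) (n : ℕ) : mu d n = ((n : ℝ) - 1 / 2) ^ 2 * (Real.pi / d) ^ 2 := by
  unfold mu
  by_cases h : d = 0
  · simp [h]
  field_simp
  ring

/-- After division by (π/d)², the inequality compares (n - 1/2)² with the radicand in `topMode`.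
Taking roots is allowed because n - 1/2 > 0. -/
lemma le_topMode_iff {d : ℝ} (hd : 0 < d) (n₀ : ℕ) (k : ℝ) {n : ℕ} (hn : 1 ≤ n) :
    n ≤ topMode d n₀ k ↔ mu d n ≤ mu d n₀ + k ^ 2 := by
  have hn' : (1 : ℝ) ≤ n := by exact_mod_cast hn
  have hpi := Real.pi_pos
  have hX : 0 ≤ ((n₀ : ℝ) - 1 / 2) ^ 2 + d ^ 2 / Real.pi ^ 2 * k ^ 2 := by positivity
  have hq : 0 < (Real.pi / d) ^ 2 := by positivity
  have key : mu d n₀ + k ^ 2 =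
      (((n₀ : ℝ) - 1 / 2) ^ 2 + d ^ 2 / Real.pi ^ 2 * k ^ 2) * (Real.pi / d) ^ 2 := by
    rw [mu_eq]
    field_simp
  rw [topMode, Nat.le_floor_iff (by positivity), key, mu_eq, mul_le_mul_iff_left₀ hq,
    ← Real.le_sqrt (by linarith)]
  · constructor <;> intro h <;> linarith
  · positivity

/-- Both branches are roots of the same quadratic relation, so propagating and evanescent modes can
be treated by one formula e^{-s|x|} from here on. -/
lemma symbolD_sq {d : ℝ} (hd : 0 < d) (n₀ : ℕ) (k : ℝ) {n : ℕ} (hn : 1 ≤ n) :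
    symbolD d n₀ k n ^ 2 = ((mu d n - (mu d n₀ + k ^ 2) : ℝ) : ℂ) := by
  unfold symbolD
  have h := le_topMode_iff hd n₀ k hn
  split_ifs with h1
  · have h2 : (0 : ℝ) ≤ mu d n₀ - mu d n + k ^ 2 := by linarith [h.1 h1]
    rw [mul_pow, neg_sq, Complex.I_sq, ← Complex.ofReal_pow, kMode, Real.sq_sqrt h2]
    push_cast
    ring
  · have h2 : (0 : ℝ) ≤ mu d n - mu d n₀ - k ^ 2 := by
      by_contra hc
      exact h1 (h.2 (by linarith))
    rw [← Complex.ofReal_pow, kappaMode, Real.sq_sqrt h2]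
    congr 1
    ring

lemma norm_symbolD_sq {d : ℝ} (hd : 0 < d) (n₀ : ℕ) (k : ℝ) {n : ℕ} (hn : 1 ≤ n) :
    ‖symbolD d n₀ k n‖ ^ 2 = |mu d n - (mu d n₀ + k ^ 2)| := by
  rw [← norm_pow, symbolD_sq hd n₀ k hn, Complex.norm_real, Real.norm_eq_abs]

lemma symbolD_re_nonneg (d : ℝ) (n₀ : ℕ) (k : ℝ) (n : ℕ) : 0 ≤ (symbolD d n₀ k n).re := by
  unfold symbolD
  split_ifs
  · simp
  · simp [kappaMode]

lemma symbolD_re_of_topMode_lt {d : ℝ} {n₀ : ℕ} {k : ℝ} {n : ℕ} (h : topMode d n₀ k < n) :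
    (symbolD d n₀ k n).re = ‖symbolD d n₀ k n‖ := by
  unfold symbolD
  rw [if_neg (by omega)]
  simp [kappaMode, abs_of_nonneg (Real.sqrt_nonneg _)]

/-- The source of coercivity: the symbol takes values only on the nonnegative real and nonpositive
imaginary axes, where x - y is the modulus of x + iy. -/
lemma re_sub_im_symbolD (d : ℝ) (n₀ : ℕ) (k : ℝ) (n : ℕ) :
    (symbolD d n₀ k n).re - (symbolD d n₀ k n).im = ‖symbolD d n₀ k n‖ := by
  unfold symbolD
  split_ifs <;> simp [kMode, kappaMode, abs_of_nonneg (Real.sqrt_nonneg _)]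

lemma symbolD_self {d : ℝ} (hd : 0 < d) {n₀ : ℕ} (hn₀ : 1 ≤ n₀) {k : ℝ} (hk : 0 < k) :
    symbolD d n₀ k n₀ = -Complex.I * k := by
  rw [symbolD, if_pos ((le_topMode_iff hd n₀ k hn₀).2 (by nlinarith)), kMode]
  simp [Real.sqrt_sq hk.le]

lemma tendsto_mu_ratio (d E : ℝ) :
    Tendsto (fun j : ℕ => (mu d (j + 1) - E) / ((j : ℝ) + 1) ^ 2) atTop
      (𝓝 ((Real.pi / d) ^ 2)) := by
  have h0 : Tendsto (fun j : ℕ => 1 / ((j : ℝ) + 1)) atTop (𝓝 0) :=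
    tendsto_one_div_add_atTop_nhds_zero_nat
  have h1 : Tendsto (fun j : ℕ => (1 - 1 / 2 * (1 / ((j : ℝ) + 1))) ^ 2 * (Real.pi / d) ^ 2
      - E * (1 / ((j : ℝ) + 1)) ^ 2) atTop
      (𝓝 ((1 - 1 / 2 * 0) ^ 2 * (Real.pi / d) ^ 2 - E * 0 ^ 2)) :=
    (((tendsto_const_nhds.sub (h0.const_mul _)).pow 2).mul_const _).sub ((h0.pow 2).const_mul E)
  have : (1 - 1 / 2 * 0 : ℝ) ^ 2 * (Real.pi / d) ^ 2 - E * 0 ^ 2 = (Real.pi / d) ^ 2 := by ring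
  rw [this] at h1
  refine h1.congr fun j => ?_
  rw [mu_eq]
  have : (j : ℝ) + 1 ≠ 0 := by positivity
  generalize (Real.pi / d) ^ 2 = q
  push_cast
  field_simp

/-- The symbol of `D` grows linearly. -/
lemma exists_symbolD_bounds {d : ℝ} (hd : 0 < d) (n₀ : ℕ) (k : ℝ)
    (hthr : ∀ n : ℕ, 1 ≤ n → mu d n₀ + k ^ 2 ≠ mu d n) :
    ∃ c C : ℝ, 0 < c ∧ 0 < C ∧ ∀ j : ℕ, c * ((j : ℝ) + 1) ≤ ‖symbolD d n₀ k (j + 1)‖ ∧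
      ‖symbolD d n₀ k (j + 1)‖ ≤ C * ((j : ℝ) + 1) := by
  set E := mu d n₀ + k ^ 2 with hE
  have hq : 0 < (Real.pi / d) ^ 2 := by have := Real.pi_pos; positivity
  have hlim : Tendsto (fun j : ℕ => ‖symbolD d n₀ k (j + 1)‖ / ((j : ℝ) + 1)) atTop
      (𝓝 (Real.sqrt |(Real.pi / d) ^ 2|)) := by
    refine ((tendsto_mu_ratio d E).abs.sqrt).congr fun j => ?_
    rw [abs_div, ← norm_symbolD_sq hd n₀ k (Nat.le_add_left 1 j), abs_of_nonneg (sq_nonneg _),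
      ← div_pow, Real.sqrt_sq (by positivity)]
  have hl : Real.sqrt |(Real.pi / d) ^ 2| ≠ 0 :=
    (Real.sqrt_pos.2 (abs_pos.2 hq.ne')).ne'
  -- The non-threshold hypothesis enters here. With the limit above it bounds the ratio and its
  -- inverse, since convergent sequences are bounded.
  have hne : ∀ j : ℕ, 0 < ‖symbolD d n₀ k (j + 1)‖ := fun j => by
    rw [norm_pos_iff]
    intro h
    have h2 := norm_symbolD_sq hd n₀ k (Nat.le_add_left 1 j)
    rw [h, norm_zero, eq_comm, zero_pow two_ne_zero, abs_eq_zero, sub_eq_zero] at h2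
    exact hthr _ (Nat.le_add_left 1 j) h2.symm
  obtain ⟨A, hA⟩ := hlim.bddAbove_range
  obtain ⟨B, hB⟩ := (hlim.inv₀ hl).bddAbove_range
  have hA' : ∀ j : ℕ, ‖symbolD d n₀ k (j + 1)‖ / ((j : ℝ) + 1) ≤ A := fun j => hA ⟨j, rfl⟩
  have hB' : ∀ j : ℕ, (‖symbolD d n₀ k (j + 1)‖ / ((j : ℝ) + 1))⁻¹ ≤ B := fun j => hB ⟨j, rfl⟩
  have hApos : 0 < A := lt_of_lt_of_le (div_pos (hne 0) (by positivity)) (hA' 0)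
  have hBpos : 0 < B :=
    lt_of_lt_of_le (inv_pos.2 (div_pos (hne 0) (by positivity))) (hB' 0)
  refine ⟨B⁻¹, A, inv_pos.2 hBpos, hApos, fun j => ⟨?_, ?_⟩⟩
  · have hj : (0 : ℝ) < (j : ℝ) + 1 := by positivity
    rw [← le_div_iff₀ hj]
    exact inv_le_of_inv_le₀ (div_pos (hne j) hj) (hB' j)
  · have hj : (0 : ℝ) < (j : ℝ) + 1 := by positivity
    rw [← div_le_iff₀ hj]
    exact hA' j

/-- The real part of the symbol of `D` grows linearly. -/
lemma exists_le_symbolD_re {d : ℝ} (hd : 0 < d) (n₀ : ℕ) (k : ℝ)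
    (hthr : ∀ n : ℕ, 1 ≤ n → mu d n₀ + k ^ 2 ≠ mu d n) :
    ∃ c B : ℝ, 0 < c ∧ ∀ j : ℕ, c * ((j : ℝ) + 1) - B ≤ (symbolD d n₀ k (j + 1)).re := by
  obtain ⟨c, _, hc, _, h⟩ := exists_symbolD_bounds hd n₀ k hthr
  refine ⟨c, c * topMode d n₀ k, hc, fun j => ?_⟩
  -- The constant c · n₁ absorbs the finitely many propagating modes, whose symbols are imaginary.
  rcases le_or_gt (j + 1) (topMode d n₀ k) with h1 | h1
  · have h2 : ((j : ℝ) + 1) ≤ topMode d n₀ k := by exact_mod_cast h1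
    have := mul_le_mul_of_nonneg_left h2 hc.le
    linarith [symbolD_re_nonneg d n₀ k (j + 1)]
  · rw [symbolD_re_of_topMode_lt h1]
    have : 0 ≤ c * topMode d n₀ k := by positivity
    linarith [(h j).1]

/-! ### The transversal modes -/

/-- Uniformly bounded eigenfunctions of `d²/dy²` with eigenvalues `-μ_n`, orthonormal
in `L²(0,d)`. -/
structure IsModeFamily (d : ℝ) (χ : ℕ → ℝ → ℝ) : Prop where
  contDiff : ∀ n, ContDiff ℝ ∞ (χ n)
  deriv_deriv : ∀ n y, deriv (deriv (χ n)) y = -mu d n * χ n y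
  abs_le : ∀ n y, |χ n y| ≤ Real.sqrt (2 / d)
  orthonormal : ∀ i j : ℕ,
    ∫ y, χ (i + 1) y * χ (j + 1) y ∂(crossMeasure d) = if i = j then 1 else 0

lemma integral_crossMeasure {d : ℝ} (hd : 0 < d) (g : ℝ → ℝ) :
    ∫ y, g y ∂(crossMeasure d) = ∫ y in (0 : ℝ)..d, g y := by
  rw [intervalIntegral.integral_of_le hd.le, crossMeasure, integral_Ioc_eq_integral_Ioo]

lemma integral_crossMeasure_complex {d : ℝ} (hd : 0 < d) (g : ℝ → ℂ) :
    ∫ y, g y ∂(crossMeasure d) = ∫ y in (0 : ℝ)..d, g y := by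
  rw [intervalIntegral.integral_of_le hd.le, crossMeasure, integral_Ioc_eq_integral_Ioo]

lemma integral_cos_int_mul {d : ℝ} (hd : 0 < d) (m : ℤ) :
    ∫ y in (0 : ℝ)..d, Real.cos (m * Real.pi / d * y) = if m = 0 then d else 0 := by
  split_ifs with h
  · simp [h]
  · have hm : (m : ℝ) ≠ 0 := by exact_mod_cast h
    have hc : (m : ℝ) * Real.pi / d ≠ 0 := by
      have := Real.pi_ne_zero
      positivity
    rw [intervalIntegral.integral_comp_mul_left _ hc, integral_cos]
    have : (m : ℝ) * Real.pi / d * d = m * Real.pi := by field_simp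
    simp [this, Real.sin_int_mul_pi]

/-- Product-to-sum form of the orthogonality relations: σ = -1 serves the sines and σ = 1 the
cosines. The frequency i + j + 1 is never zero, so only the difference frequency contributes. -/
lemma orthonormal_aux {d : ℝ} (hd : 0 < d) (i j : ℕ) (σ : ℝ) :
    ∫ y in (0 : ℝ)..d, 1 / d * (Real.cos (((i : ℤ) - (j : ℤ) : ℤ) * Real.pi / d * y) +
      σ * Real.cos (((i : ℤ) + (j : ℤ) + 1 : ℤ) * Real.pi / d * y)) = if i = j then 1 else 0 := by
  have hi : ∀ m : ℤ, IntervalIntegrable (fun y : ℝ => Real.cos (m * Real.pi / d * y))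
      volume 0 d := fun m => Continuous.intervalIntegrable (by fun_prop) _ _
  rw [intervalIntegral.integral_const_mul,
    intervalIntegral.integral_add (hi _) ((hi _).const_mul σ),
    intervalIntegral.integral_const_mul, integral_cos_int_mul hd, integral_cos_int_mul hd,
    if_neg (show ¬ ((i : ℤ) + (j : ℤ) + 1 = 0) by omega)]
  by_cases h : i = j
  · rw [if_pos (by omega), if_pos h]
    field_simp
    ring
  · rw [if_neg (by omega), if_neg h]
    simp

lemma isModeFamily_chiMinus {d : ℝ} (hd : 0 < d) : IsModeFamily d (chiMinus d) where
  contDiff n := by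
    unfold chiMinus
    fun_prop
  deriv_deriv n y := by
    have h1 : deriv (chiMinus d n) = fun y => Real.sqrt (2 / d) *
        (Real.cos ((2 * (n : ℝ) - 1) * (Real.pi * y / (2 * d))) *
          ((2 * (n : ℝ) - 1) * (Real.pi * 1 / (2 * d)))) := by
      funext y
      exact (((((hasDerivAt_id y).const_mul Real.pi).div_const (2 * d)).const_mul
        (2 * (n : ℝ) - 1)).sin.const_mul (Real.sqrt (2 / d))).deriv
    rw [h1]
    have h2 := ((((((hasDerivAt_id y).const_mul Real.pi).div_const (2 * d)).const_mul
        (2 * (n : ℝ) - 1)).cos.mul_const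
          ((2 * (n : ℝ) - 1) * (Real.pi * 1 / (2 * d)))).const_mul (Real.sqrt (2 / d))).deriv
    simp only [id] at h2
    rw [h2, chiMinus, mu]
    field_simp
    ring
  abs_le n y := by
    rw [chiMinus, abs_mul, abs_of_nonneg (Real.sqrt_nonneg _)]
    exact mul_le_of_le_one_right (Real.sqrt_nonneg _) (Real.abs_sin_le_one _)
  orthonormal i j := by
    rw [integral_crossMeasure hd, ← orthonormal_aux hd i j (-1)]
    congr 1
    funext y
    have hs : Real.sqrt (2 / d) * Real.sqrt (2 / d) = 2 / d :=
      Real.mul_self_sqrt (by positivity)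
    have h1 : (((i : ℤ) - (j : ℤ) : ℤ) : ℝ) * Real.pi / d * y =
        (2 * ((i + 1 : ℕ) : ℝ) - 1) * (Real.pi * y / (2 * d)) -
          (2 * ((j + 1 : ℕ) : ℝ) - 1) * (Real.pi * y / (2 * d)) := by
      push_cast
      field_simp
      ring
    have h2 : (((i : ℤ) + (j : ℤ) + 1 : ℤ) : ℝ) * Real.pi / d * y =
        (2 * ((i + 1 : ℕ) : ℝ) - 1) * (Real.pi * y / (2 * d)) +
          (2 * ((j + 1 : ℕ) : ℝ) - 1) * (Real.pi * y / (2 * d)) := by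
      push_cast
      field_simp
      ring
    rw [h1, h2, Real.cos_sub, Real.cos_add, chiMinus, chiMinus, mul_mul_mul_comm, hs]
    ring

lemma isModeFamily_chiPlus {d : ℝ} (hd : 0 < d) : IsModeFamily d (chiPlus d) where
  contDiff n := by
    unfold chiPlus
    fun_prop
  deriv_deriv n y := by
    have h1 : deriv (chiPlus d n) = fun y => Real.sqrt (2 / d) *
        (-Real.sin ((2 * (n : ℝ) - 1) * (Real.pi * y / (2 * d))) *
          ((2 * (n : ℝ) - 1) * (Real.pi * 1 / (2 * d)))) := by
      funext y
      exact (((((hasDerivAt_id y).const_mul Real.pi).div_const (2 * d)).const_mul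
        (2 * (n : ℝ) - 1)).cos.const_mul (Real.sqrt (2 / d))).deriv
    rw [h1]
    have h2 := ((((((hasDerivAt_id y).const_mul Real.pi).div_const (2 * d)).const_mul
        (2 * (n : ℝ) - 1)).sin.neg.mul_const
          ((2 * (n : ℝ) - 1) * (Real.pi * 1 / (2 * d)))).const_mul (Real.sqrt (2 / d))).deriv
    simp only [id] at h2
    refine h2.trans ?_
    rw [chiPlus, mu]
    field_simp
    ring
  abs_le n y := by
    rw [chiPlus, abs_mul, abs_of_nonneg (Real.sqrt_nonneg _)]
    exact mul_le_of_le_one_right (Real.sqrt_nonneg _) (Real.abs_cos_le_one _)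
  orthonormal i j := by
    rw [integral_crossMeasure hd, ← orthonormal_aux hd i j 1]
    congr 1
    funext y
    have hs : Real.sqrt (2 / d) * Real.sqrt (2 / d) = 2 / d :=
      Real.mul_self_sqrt (by positivity)
    have h1 : (((i : ℤ) - (j : ℤ) : ℤ) : ℝ) * Real.pi / d * y =
        (2 * ((i + 1 : ℕ) : ℝ) - 1) * (Real.pi * y / (2 * d)) -
          (2 * ((j + 1 : ℕ) : ℝ) - 1) * (Real.pi * y / (2 * d)) := by
      push_cast
      field_simp
      ring
    have h2 : (((i : ℤ) + (j : ℤ) + 1 : ℤ) : ℝ) * Real.pi / d * y =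
        (2 * ((i + 1 : ℕ) : ℝ) - 1) * (Real.pi * y / (2 * d)) +
          (2 * ((j + 1 : ℕ) : ℝ) - 1) * (Real.pi * y / (2 * d)) := by
      push_cast
      field_simp
      ring
    rw [h1, h2, Real.cos_sub, Real.cos_add, chiPlus, chiPlus, mul_mul_mul_comm, hs]
    ring

instance (d : ℝ) : IsFiniteMeasure (crossMeasure d) := by
  unfold crossMeasure
  infer_instance

/-! ### Mode expansions in L²(0,d) -/

namespace IsModeFamily

variable {d : ℝ} {χ : ℕ → ℝ → ℝ}

lemma continuous_ofReal (h : IsModeFamily d χ) (n : ℕ) : Continuous fun y => (χ n y : ℂ) :=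
  Complex.continuous_ofReal.comp (h.contDiff n).continuous

lemma norm_le (h : IsModeFamily d χ) (n : ℕ) (y : ℝ) : ‖(χ n y : ℂ)‖ ≤ Real.sqrt (2 / d) := by
  rw [Complex.norm_real]
  exact h.abs_le n y

lemma memLp (h : IsModeFamily d χ) (n : ℕ) : MemLp (fun y => (χ n y : ℂ)) 2 (crossMeasure d) :=
  MemLp.of_bound (h.continuous_ofReal n).aestronglyMeasurable _
    (Eventually.of_forall (h.norm_le n))

/-- The mode with index `j + 1` as an element of `L²(0,d)`. -/
def modeLp (h : IsModeFamily d χ) (j : ℕ) : Lp ℂ 2 (crossMeasure d) := (h.memLp (j + 1)).toLp _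

lemma inner_modeLp_toLp (h : IsModeFamily d χ) (j : ℕ) {g : ℝ → ℂ}
    (hg : MemLp g 2 (crossMeasure d)) :
    inner ℂ (h.modeLp j) (hg.toLp g) = coeff d χ (j + 1) g := by
  rw [L2.inner_def, coeff]
  refine integral_congr_ae ?_
  filter_upwards [(h.memLp (j + 1)).coeFn_toLp, hg.coeFn_toLp] with y h1 h2
  rw [modeLp, h1, h2]
  simp [mul_comm]

lemma orthonormal_modeLp (h : IsModeFamily d χ) : Orthonormal ℂ h.modeLp := by
  rw [orthonormal_iff_ite]
  intro i j
  rw [show h.modeLp j = (h.memLp (j + 1)).toLp _ from rfl, inner_modeLp_toLp, coeff]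
  have := h.orthonormal i j
  have h2 : ∫ y, (χ (i + 1) y : ℂ) * (χ (j + 1) y : ℂ) ∂(crossMeasure d) =
      ((∫ y, χ (i + 1) y * χ (j + 1) y ∂(crossMeasure d) : ℝ) : ℂ) := by
    rw [← integral_complex_ofReal]
    simp
  rw [h2, this]
  split_ifs <;> simp

/-- The isometry `a ↦ ∑ a_j χ_{j+1}` from `ℓ²` to `L²(0,d)`. -/
def synth (h : IsModeFamily d χ) : lp (fun _ : ℕ => ℂ) 2 →ₗᵢ[ℂ] Lp ℂ 2 (crossMeasure d) :=
  h.orthonormal_modeLp.orthogonalFamily.linearIsometry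

lemma hasSum_synth (h : IsModeFamily d χ) (a : lp (fun _ : ℕ => ℂ) 2) :
    HasSum (fun j => a j • h.modeLp j) (h.synth a) :=
  h.orthonormal_modeLp.orthogonalFamily.hasSum_linearIsometry a

lemma inner_modeLp_synth (h : IsModeFamily d χ) (a : lp (fun _ : ℕ => ℂ) 2) (j : ℕ) :
    inner ℂ (h.modeLp j) (h.synth a) = a j := by
  have h1 := (h.hasSum_synth a).mapL (innerSL ℂ (h.modeLp j))
  have h2 := hasSum_single (f := fun i => innerSL ℂ (h.modeLp j) (a i • h.modeLp i)) j
    (fun i hi => by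
      simp [h.orthonormal_modeLp.inner_eq_zero hi.symm])
  have h3 := h1.unique h2
  simpa [inner_smul_right, h.orthonormal_modeLp.1 j] using h3

lemma coeff_of_ae_eq_synth (h : IsModeFamily d χ) {a : lp (fun _ : ℕ => ℂ) 2} {g : ℝ → ℂ}
    (hg : g =ᵐ[crossMeasure d] h.synth a) (j : ℕ) : coeff d χ (j + 1) g = a j := by
  have hg' : MemLp g 2 (crossMeasure d) := (memLp_congr_ae hg).2 (Lp.memLp _)
  rw [← h.inner_modeLp_toLp j hg', ← h.inner_modeLp_synth a j]
  congr 1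
  exact Lp.ext (hg'.coeFn_toLp.trans hg)

lemma sum_Icc_eq_sum_range {M : Type*} [AddCommMonoid M] (F : ℕ → M) (N : ℕ) :
    ∑ n ∈ Finset.Icc 1 N, F n = ∑ j ∈ Finset.range N, F (j + 1) := by
  induction N with
  | zero => simp
  | succ N ih => rw [Finset.sum_Icc_succ_top (by omega), ih, Finset.sum_range_succ]

lemma coeFn_sum_modeLp (h : IsModeFamily d χ) (a : ℕ → ℂ) (N : ℕ) :
    (∑ j ∈ Finset.range N, a j • h.modeLp j : Lp ℂ 2 (crossMeasure d)) =ᵐ[crossMeasure d]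
      fun y => ∑ j ∈ Finset.range N, a j * (χ (j + 1) y : ℂ) := by
  induction N with
  | zero =>
    simp only [Finset.range_zero, Finset.sum_empty]
    exact Lp.coeFn_zero ℂ 2 (crossMeasure d)
  | succ N ih =>
    rw [Finset.sum_range_succ]
    filter_upwards [Lp.coeFn_add (∑ j ∈ Finset.range N, a j • h.modeLp j) (a N • h.modeLp N), ih,
      Lp.coeFn_smul (a N) (h.modeLp N), (h.memLp (N + 1)).coeFn_toLp] with y h1 h2 h3 h4
    rw [h1, Pi.add_apply, h2, h3, Pi.smul_apply, modeLp, h4, Finset.sum_range_succ, smul_eq_mul]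

lemma eLpNorm_sub_sum (h : IsModeFamily d χ) {g : ℝ → ℂ} (hg : MemLp g 2 (crossMeasure d))
    (a : ℕ → ℂ) (N : ℕ) :
    eLpNorm (fun y => g y - ∑ j ∈ Finset.range N, a j * (χ (j + 1) y : ℂ)) 2 (crossMeasure d) =
      ‖hg.toLp g - ∑ j ∈ Finset.range N, a j • h.modeLp j‖ₑ := by
  rw [Lp.enorm_def]
  refine eLpNorm_congr_ae ?_
  filter_upwards [Lp.coeFn_sub (hg.toLp g) (∑ j ∈ Finset.range N, a j • h.modeLp j),
    hg.coeFn_toLp, h.coeFn_sum_modeLp a N] with y h1 h2 h3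
  rw [h1, Pi.sub_apply, h2, h3]

lemma tendsto_eLpNorm_iff (h : IsModeFamily d χ) {g : ℝ → ℂ} (hg : MemLp g 2 (crossMeasure d))
    (c : ℕ → ℂ) :
    Tendsto (fun N : ℕ => eLpNorm (fun y => g y - ∑ n ∈ Finset.Icc 1 N, c n * (χ n y : ℂ)) 2
      (crossMeasure d)) atTop (𝓝 0) ↔
    Tendsto (fun N : ℕ => ∑ j ∈ Finset.range N, c (j + 1) • h.modeLp j) atTop
      (𝓝 (hg.toLp g)) := by
  simp_rw [fun N y => sum_Icc_eq_sum_range (fun n => c n * (χ n y : ℂ)) N]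
  simp_rw [fun N => h.eLpNorm_sub_sum hg (fun j => c (j + 1)) N]
  rw [tendsto_iff_edist_tendsto_0]
  simp_rw [edist_comm _ (hg.toLp g), edist_eq_enorm_sub]

lemma memSobolev_of_ae_eq_synth (h : IsModeFamily d χ) {a : lp (fun _ : ℕ => ℂ) 2} {g : ℝ → ℂ}
    (hg : g =ᵐ[crossMeasure d] h.synth a)
    (hs : Summable fun j : ℕ => ((j : ℝ) + 1) * ‖a j‖ ^ 2) : MemSobolev d χ (1 / 2) g := by
  have hg' : MemLp g 2 (crossMeasure d) := (memLp_congr_ae hg).2 (Lp.memLp _)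
  -- Modes are numbered from 1 and ℓ² coordinates from 0; the value at n = 0 is never used.
  refine ⟨hg', fun n => a (n - 1), ?_, ?_⟩
  · rw [h.tendsto_eLpNorm_iff hg']
    have : hg'.toLp g = h.synth a := Lp.ext (hg'.coeFn_toLp.trans hg)
    rw [this]
    exact (h.hasSum_synth a).tendsto_sum_nat
  · simpa using hs

lemma exists_synth_of_memSobolev (h : IsModeFamily d χ) {g : ℝ → ℂ}
    (hg : MemSobolev d χ (1 / 2) g) :
    ∃ a : lp (fun _ : ℕ => ℂ) 2, g =ᵐ[crossMeasure d] h.synth a ∧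
      Summable fun j : ℕ => ((j : ℝ) + 1) * ‖a j‖ ^ 2 := by
  obtain ⟨hg', c, hc, hs⟩ := hg
  have hs' : Summable fun j : ℕ => ((j : ℝ) + 1) * ‖c (j + 1)‖ ^ 2 := by simpa using hs
  have hs2 : Summable fun j : ℕ => ‖c (j + 1)‖ ^ 2 :=
    Summable.of_nonneg_of_le (fun j => sq_nonneg _)
      (fun j => le_mul_of_one_le_left (sq_nonneg _) (by linarith [(Nat.cast_nonneg j : (0:ℝ) ≤ j)]))
      hs'
  have hm : Memℓp (fun j => c (j + 1)) 2 := memℓp_gen (by simpa using hs2)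
  refine ⟨⟨fun j => c (j + 1), hm⟩, ?_, hs'⟩
  have h1 := (h.tendsto_eLpNorm_iff hg' c).1 hc
  have h2 := (h.hasSum_synth ⟨fun j => c (j + 1), hm⟩).tendsto_sum_nat
  have h3 := tendsto_nhds_unique h1 h2
  rw [← h3]
  exact hg'.coeFn_toLp.symm

/-- Pointwise sums of mode expansions agree with their sums in `L²(0,d)`. -/
lemma ae_eq_synth_of_hasSum (h : IsModeFamily d χ) (a : lp (fun _ : ℕ => ℂ) 2) {g : ℝ → ℂ}
    (hg : ∀ y ∈ Ioo 0 d, HasSum (fun j => a j * (χ (j + 1) y : ℂ)) (g y)) :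
    g =ᵐ[crossMeasure d] h.synth a := by
  -- L² convergence gives almost everywhere convergence along a subsequence, whose limit must be the
  -- pointwise sum.
  have h1 := tendstoInMeasure_of_tendsto_Lp (h.hasSum_synth a).tendsto_sum_nat
  obtain ⟨ns, hns, hae⟩ := h1.exists_seq_tendsto_ae
  have h2 : ∀ᵐ y ∂(crossMeasure d), ∀ N : ℕ,
      (∑ j ∈ Finset.range N, a j • h.modeLp j : Lp ℂ 2 (crossMeasure d)) y =
        ∑ j ∈ Finset.range N, a j * (χ (j + 1) y : ℂ) :=
    ae_all_iff.2 fun N => h.coeFn_sum_modeLp _ N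
  have h3 : ∀ᵐ y ∂(crossMeasure d), y ∈ Ioo 0 d := ae_restrict_mem measurableSet_Ioo
  filter_upwards [hae, h2, h3] with y hy1 hy2 hy3
  simp_rw [hy2] at hy1
  exact tendsto_nhds_unique ((hg y hy3).tendsto_sum_nat.comp hns.tendsto_atTop) hy1

end IsModeFamily

/-! ### Expansion of test functions on the cross-section -/

lemma contDiff_deriv {u : ℝ → ℂ} (hu : ContDiff ℝ ∞ u) : ContDiff ℝ ∞ (deriv u) :=
  (contDiff_infty_iff_deriv.1 hu).2

lemma hasDerivAt_of_contDiff {u : ℝ → ℂ} (hu : ContDiff ℝ ∞ u) (y : ℝ) :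
    HasDerivAt u (deriv u y) y :=
  (hu.differentiable (by simp) y).hasDerivAt

/-- Green's identity on an interval. -/
lemma integral_green {u ψ : ℝ → ℂ} (hu : ContDiff ℝ ∞ u) (hψ : ContDiff ℝ ∞ ψ) (a b : ℝ) :
    ∫ y in a..b, (u y * deriv (deriv ψ) y - deriv (deriv u) y * ψ y) =
      (u b * deriv ψ b - deriv u b * ψ b) - (u a * deriv ψ a - deriv u a * ψ a) := by
  have hu1 := contDiff_deriv hu
  have hψ1 := contDiff_deriv hψ
  refine intervalIntegral.integral_eq_sub_of_hasDerivAt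
    (f := fun y => u y * deriv ψ y - deriv u y * ψ y) (fun y _ => ?_) ?_
  · convert! ((hasDerivAt_of_contDiff hu y).mul (hasDerivAt_of_contDiff hψ1 y)).sub
      ((hasDerivAt_of_contDiff hu1 y).mul (hasDerivAt_of_contDiff hψ y)) using 1
    ring
  · exact ((hu.continuous.mul (contDiff_deriv hψ1).continuous).sub
      ((contDiff_deriv hu1).continuous.mul hψ.continuous)).intervalIntegrable _ _

/-- Smooth functions on the line with support inside `(0,d)`. -/
structure IsCrossTest (d : ℝ) (ψ : ℝ → ℂ) : Prop where
  contDiff : ContDiff ℝ ∞ ψ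
  tsupport_subset : tsupport ψ ⊆ Ioo 0 d

namespace IsCrossTest

variable {d : ℝ} {ψ : ℝ → ℂ}

lemma eq_zero (h : IsCrossTest d ψ) {y : ℝ} (hy : y ∉ Ioo 0 d) : ψ y = 0 :=
  image_eq_zero_of_notMem_tsupport fun h' => hy (h.tsupport_subset h')

lemma deriv_eq_zero (h : IsCrossTest d ψ) {y : ℝ} (hy : y ∉ Ioo 0 d) : deriv ψ y = 0 := by
  have h1 : ψ =ᶠ[𝓝 y] 0 := notMem_tsupport_iff_eventuallyEq.1 fun h' => hy (h.tsupport_subset h')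
  rw [h1.deriv_eq]
  simp

lemma integral_mul_deriv_deriv (h : IsCrossTest d ψ) {u : ℝ → ℂ} (hu : ContDiff ℝ ∞ u) {c : ℂ}
    (hc : ∀ y, deriv (deriv u) y = c * u y) :
    ∫ y in (0 : ℝ)..d, u y * deriv (deriv ψ) y = c * ∫ y in (0 : ℝ)..d, u y * ψ y := by
  have h1 := integral_green hu h.contDiff 0 d
  have h0 : (0 : ℝ) ∉ Ioo 0 d := by simp
  have hd : d ∉ Ioo 0 d := by simp
  rw [h.eq_zero h0, h.eq_zero hd, h.deriv_eq_zero h0, h.deriv_eq_zero hd,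
    intervalIntegral.integral_sub] at h1
  · simp only [mul_zero, sub_self, sub_eq_zero] at h1
    rw [h1, ← intervalIntegral.integral_const_mul]
    simp_rw [hc, mul_assoc]
  · exact (hu.continuous.mul
      (contDiff_deriv (contDiff_deriv h.contDiff)).continuous).intervalIntegrable _ _
  · exact ((contDiff_deriv (contDiff_deriv hu)).continuous.mul
      h.contDiff.continuous).intervalIntegrable _ _

/-- Moving two derivatives onto ψ, with no boundary terms, gains the eigenvalue c. This yields the
quadratic decay of all coefficients used below. -/
lemma norm_mul_norm_integral_le (h : IsCrossTest d ψ) (hd : 0 < d) {u : ℝ → ℂ}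
    (hu : ContDiff ℝ ∞ u) {c : ℂ} (hc : ∀ y, deriv (deriv u) y = c * u y) {B : ℝ}
    (hB : ∀ y, ‖u y‖ ≤ B) :
    ‖c‖ * ‖∫ y in (0 : ℝ)..d, u y * ψ y‖ ≤ B * ∫ y in (0 : ℝ)..d, ‖deriv (deriv ψ) y‖ := by
  have hc2 := (contDiff_deriv (contDiff_deriv h.contDiff)).continuous
  rw [← norm_mul, ← h.integral_mul_deriv_deriv hu hc, ← intervalIntegral.integral_const_mul]
  refine (intervalIntegral.norm_integral_le_integral_norm hd.le).trans ?_
  refine intervalIntegral.integral_mono_on hd.le ?_ ?_ fun y _ => ?_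
  · exact (hu.continuous.mul hc2).norm.intervalIntegrable _ _
  · exact (continuous_const.mul hc2.norm).intervalIntegrable _ _
  · rw [norm_mul]
    exact mul_le_mul_of_nonneg_right (hB y) (norm_nonneg _)

/-- The `m`-th Fourier coefficient of `ψ` on the circle of length `4d`. -/
def circleCoeff (d : ℝ) (ψ : ℝ → ℂ) (m : ℤ) : ℂ :=
  1 / (4 * d) * ∫ y in (0 : ℝ)..d, Complex.exp (Complex.I * (-m * (Real.pi * y / (2 * d)))) * ψ y

lemma exp_mode_contDiff (d : ℝ) (m : ℂ) : ContDiff ℝ ∞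
    (fun y : ℝ => Complex.exp (Complex.I * (m * (Real.pi * y / (2 * d))))) := by
  have : ContDiff ℝ ∞ (fun y : ℝ => (y : ℂ)) := Complex.ofRealCLM.contDiff
  fun_prop

lemma exp_mode_deriv_deriv (d : ℝ) (m : ℂ) (y : ℝ) :
    deriv (deriv (fun y : ℝ => Complex.exp (Complex.I * (m * (Real.pi * y / (2 * d)))))) y =
      (Complex.I * (m * (Real.pi / (2 * d)))) ^ 2 *
        Complex.exp (Complex.I * (m * (Real.pi * y / (2 * d)))) := by
  have h1 : ∀ y : ℝ, HasDerivAt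
      (fun y : ℝ => Complex.exp (Complex.I * (m * (Real.pi * y / (2 * d)))))
      (Complex.I * (m * (Real.pi / (2 * d))) *
        Complex.exp (Complex.I * (m * (Real.pi * y / (2 * d))))) y := fun y => by
    convert! ((((((hasDerivAt_id y).ofReal_comp).const_mul (Real.pi : ℂ)).div_const
      (2 * d : ℂ)).const_mul m).const_mul Complex.I).cexp using 1
    simp only [id]
    push_cast
    ring
  have h2 : deriv (fun y : ℝ => Complex.exp (Complex.I * (m * (Real.pi * y / (2 * d))))) =
      fun y : ℝ => Complex.I * (m * (Real.pi / (2 * d))) *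
        Complex.exp (Complex.I * (m * (Real.pi * y / (2 * d)))) := funext fun y => (h1 y).deriv
  rw [h2, ((h1 y).const_mul _).deriv]
  ring

lemma summable_circleCoeff (h : IsCrossTest d ψ) (hd : 0 < d) : Summable (circleCoeff d ψ) := by
  set K := ∫ y in (0 : ℝ)..d, ‖deriv (deriv ψ) y‖
  have hpi := Real.pi_pos
  have hsum : Summable fun m : ℤ => 1 / (4 * d) * (K / (Real.pi / (2 * d)) ^ 2) *
      (1 / (m : ℝ) ^ 2) := (Real.summable_one_div_int_pow.2 (by norm_num)).mul_left _
  refine Summable.of_norm_bounded_eventually hsum ?_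
  have hfin : ∀ᶠ m : ℤ in cofinite, m ≠ 0 := by
    rw [eventually_cofinite]
    simp
  filter_upwards [hfin] with m hm
  have hm' : (0 : ℝ) < (m : ℝ) ^ 2 := by
    have : (m : ℝ) ≠ 0 := by exact_mod_cast hm
    positivity
  have h1 := h.norm_mul_norm_integral_le hd (exp_mode_contDiff d (-m)) (exp_mode_deriv_deriv d (-m))
    (B := 1) (fun y => by
      rw [show Complex.I * (-(m : ℂ) * (Real.pi * y / (2 * d))) =
        ((-m * (Real.pi * y / (2 * d)) : ℝ) : ℂ) * Complex.I by push_cast; ring,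
        Complex.norm_exp_ofReal_mul_I])
  have h2 : ‖(Complex.I * (-(m : ℂ) * (Real.pi / (2 * d)))) ^ 2‖ =
      (m : ℝ) ^ 2 * (Real.pi / (2 * d)) ^ 2 := by
    rw [show (Complex.I * (-(m : ℂ) * (Real.pi / (2 * d)))) ^ 2 =
      ((-((m : ℝ) ^ 2 * (Real.pi / (2 * d)) ^ 2) : ℝ) : ℂ) by
        push_cast; rw [mul_pow, Complex.I_sq]; ring, Complex.norm_real, norm_neg,
      Real.norm_of_nonneg (by positivity)]
  rw [h2, one_mul] at h1
  have h3 : ‖(1 / (4 * d) : ℂ)‖ = 1 / (4 * d) := by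
    rw [show (1 / (4 * d) : ℂ) = ((1 / (4 * d) : ℝ) : ℂ) by push_cast; ring, Complex.norm_real,
      Real.norm_of_nonneg (by positivity)]
  rw [circleCoeff, norm_mul, h3, mul_assoc]
  refine mul_le_mul_of_nonneg_left ?_ (by positivity)
  rw [div_mul_eq_mul_div, mul_one_div, div_div, le_div_iff₀ (by positivity)]
  linarith [h1]

/-- The smooth function ψ vanishes outside (0,d), so its restriction to [-2d,2d) closes up to a
continuous function on the circle, whose Fourier coefficients are absolutely summable. -/
lemma hasSum_circle (h : IsCrossTest d ψ) (hd : 0 < d) {y : ℝ} (hy : y ∈ Ioo (-(2 * d)) (2 * d)) :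
    HasSum (fun m : ℤ => circleCoeff d ψ m *
      Complex.exp (Complex.I * (m * (Real.pi * y / (2 * d))))) (ψ y) := by
  have hT : Fact (0 < 4 * d) := ⟨by positivity⟩
  have hd' : (d : ℂ) ≠ 0 := by exact_mod_cast hd.ne'
  have hz : ψ (-(2 * d)) = ψ (-(2 * d) + 4 * d) := by
    rw [h.eq_zero (by simp [hd.le]), h.eq_zero (by simp; intro; linarith)]
  let F : C(AddCircle (4 * d), ℂ) := ⟨AddCircle.liftIco (4 * d) (-(2 * d)) ψ,
    AddCircle.liftIco_continuous hz h.contDiff.continuous.continuousOn⟩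
  have hF : ∀ m : ℤ, fourierCoeff F m = circleCoeff d ψ m := fun m => by
    show fourierCoeff (AddCircle.liftIco (4 * d) (-(2 * d)) ψ) m = _
    rw [fourierCoeff_liftIco_eq, fourierCoeffOn_eq_integral, circleCoeff]
    have hs : ∀ u : ℝ → ℂ, Function.support (fun y => u y * ψ y) ⊆ Ioo 0 d := fun u y hy => by
      by_contra hc
      exact hy (by simp [h.eq_zero hc])
    rw [intervalIntegral.integral_eq_integral_of_support_subset
        ((hs _).trans Ioo_subset_Ioc_self),
      intervalIntegral.integral_eq_integral_of_support_subset, Complex.real_smul]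
    · congr 1
      · push_cast
        ring
      · refine integral_congr_ae (Eventually.of_forall fun y => ?_)
        simp only [fourier_coe_apply, smul_eq_mul]
        congr 2
        push_cast
        field_simp
        ring
    · intro y hy
      have := hs _ hy
      exact ⟨by linarith [this.1], by linarith [this.2]⟩
  have hsum : Summable (fourierCoeff F) := by
    rw [funext hF]
    exact h.summable_circleCoeff hd
  have h1 := has_pointwise_sum_fourier_series_of_summable hsum (y : AddCircle (4 * d))
  have h2 : F (y : AddCircle (4 * d)) = ψ y :=
    AddCircle.liftIco_coe_apply ⟨hy.1.le, by linarith [hy.2]⟩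
  rw [h2] at h1
  refine h1.congr_fun fun m => ?_
  rw [hF, smul_eq_mul, fourier_coe_apply]
  congr 2
  push_cast
  field_simp
  ring

lemma exp_odd_mul_pi (j : ℤ) : Complex.exp (Complex.I * ((2 * j + 1 : ℤ) * Real.pi)) = -1 := by
  rw [show Complex.I * (((2 * j + 1 : ℤ) : ℂ) * (Real.pi : ℂ)) =
    j * (2 * Real.pi * Complex.I) + Real.pi * Complex.I by push_cast; ring,
    Complex.exp_add, Complex.exp_int_mul_two_pi_mul_I, Complex.exp_pi_mul_I, one_mul]

/-- At y, the reflected and translated arguments -y, 2d - y and y - 2d lie outside (0,d), where ψ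
vanishes. Hence ψ(y) = ψ(y) + εψ(-y) - εψ(2d - y) - ψ(y - 2d), and in this combination the even
frequencies cancel while the odd ones double. The value ε = -1 produces sines and ε = 1 cosines. -/
lemma hasSum_odd (h : IsCrossTest d ψ) (hd : 0 < d) {y : ℝ} (hy : y ∈ Ioo 0 d) {ε : ℂ}
    (hε : ε ^ 2 = 1) :
    HasSum (fun j : ℕ => 2 * (circleCoeff d ψ (2 * j + 1) + ε * circleCoeff d ψ (-(2 * j + 1))) *
      (Complex.exp (Complex.I * ((2 * j + 1) * (Real.pi * y / (2 * d)))) +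
        ε * Complex.exp (-(Complex.I * ((2 * j + 1) * (Real.pi * y / (2 * d))))))) (ψ y) := by
  have hd' : (d : ℂ) ≠ 0 := by exact_mod_cast hd.ne'
  have s1 := h.hasSum_circle hd (y := y) ⟨by linarith [hy.1], by linarith [hy.2]⟩
  have s2 := h.hasSum_circle hd (y := -y) ⟨by linarith [hy.2], by linarith [hy.1]⟩
  have s3 := h.hasSum_circle hd (y := 2 * d - y) ⟨by linarith [hy.2], by linarith [hy.1]⟩
  have s4 := h.hasSum_circle hd (y := y - 2 * d) ⟨by linarith [hy.1], by linarith [hy.2]⟩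
  rw [h.eq_zero (fun hc => by linarith [hc.1, hy.1])] at s2
  rw [h.eq_zero (fun hc => by linarith [hc.2, hy.2])] at s3
  rw [h.eq_zero (fun hc => by linarith [hc.1, hy.2])] at s4
  have s := ((s1.add (s2.mul_left ε)).sub (s3.mul_left ε)).sub s4
  simp only [mul_zero, add_zero, sub_zero] at s
  have e3 : ∀ m : ℤ, Complex.exp (Complex.I * (m * (Real.pi * (2 * d - y : ℝ) / (2 * d)))) =
      Complex.exp (Complex.I * (m * Real.pi)) *
        Complex.exp (-(Complex.I * (m * (Real.pi * y / (2 * d))))) := fun m => by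
    rw [← Complex.exp_add]
    congr 1
    push_cast
    field_simp
    ring
  have e4 : ∀ m : ℤ, Complex.exp (Complex.I * (m * (Real.pi * (y - 2 * d : ℝ) / (2 * d)))) =
      Complex.exp (-(Complex.I * (m * Real.pi))) *
        Complex.exp (Complex.I * (m * (Real.pi * y / (2 * d)))) := fun m => by
    rw [← Complex.exp_add]
    congr 1
    push_cast
    field_simp
    ring
  have e2 : ∀ m : ℤ, Complex.exp (Complex.I * (m * (Real.pi * (-y : ℝ) / (2 * d)))) =
        Complex.exp (-(Complex.I * (m * (Real.pi * y / (2 * d))))) := fun m => by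
    congr 1
    push_cast
    ring
  simp only [e2, e3, e4] at s
  have hinj : Function.Injective fun l : ℤ => 2 * l + 1 := fun a b hab => by
    simp only at hab
    omega
  rw [← hinj.hasSum_iff] at s
  -- Pair the frequencies 2j + 1 and -(2j + 1), which are the images of j and -(j + 1) under l ↦ 2l
  -- + 1.
  · have s' := s.nat_add_neg_add_one
    refine s'.congr_fun fun j => ?_
    have hneg : (2 * -((j : ℤ) + 1) + 1) = -(2 * j + 1) := by ring
    simp only [Function.comp, hneg]
    have p1 := exp_odd_mul_pi j
    have p2 : Complex.exp (-(Complex.I * ((2 * j + 1 : ℤ) * Real.pi))) = -1 := by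
      rw [Complex.exp_neg, p1]
      norm_num
    have p3 : Complex.exp (Complex.I * ((-(2 * j + 1) : ℤ) * Real.pi)) = -1 := by
      rw [← p2]
      congr 1
      push_cast
      ring
    have p4 : Complex.exp (-(Complex.I * ((-(2 * j + 1) : ℤ) * Real.pi))) = -1 := by
      rw [← p1]
      congr 1
      push_cast
      ring
    rw [p1, p2, p3, p4]
    push_cast
    simp only [neg_mul, mul_neg, neg_neg]
    generalize Complex.exp (Complex.I * ((2 * j + 1) * (Real.pi * y / (2 * d)))) = z
    generalize Complex.exp (-(Complex.I * ((2 * j + 1) * (Real.pi * y / (2 * d))))) = w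
    linear_combination (2 * circleCoeff d ψ (-(2 * (j : ℤ) + 1)) * w) * hε
  · intro m hm
    have hev : Even m := by
      rw [← Int.not_odd_iff_even]
      rintro ⟨l, rfl⟩
      exact hm ⟨l, rfl⟩
    obtain ⟨l, rfl⟩ := hev
    have p1 : Complex.exp (Complex.I * ((l + l : ℤ) * Real.pi)) = 1 := by
      rw [show Complex.I * (((l + l : ℤ) : ℂ) * (Real.pi : ℂ)) =
        l * (2 * Real.pi * Complex.I) by push_cast; ring, Complex.exp_int_mul_two_pi_mul_I]
    rw [Complex.exp_neg (Complex.I * ((l + l : ℤ) * Real.pi)), p1]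
    ring

/-- Passes from exponentials to real modes. Expanding the coefficient of ψ against χ gives a factor
κ², while `hasSum_odd` carries ε/(2d); the condition on κ equates them. -/
lemma hasSum_coeff_of_exp (h : IsCrossTest d ψ) (hd : 0 < d) {χ : ℕ → ℝ → ℝ} {ε κ : ℂ}
    (hε : ε ^ 2 = 1) (hκ : 2 * d * κ ^ 2 = ε)
    (hχ : ∀ (j : ℕ) (y : ℝ), (χ (j + 1) y : ℂ) =
      κ * (Complex.exp (Complex.I * ((2 * j + 1) * (Real.pi * y / (2 * d)))) +
        ε * Complex.exp (-(Complex.I * ((2 * j + 1) * (Real.pi * y / (2 * d)))))))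
    {y : ℝ} (hy : y ∈ Ioo 0 d) :
    HasSum (fun j : ℕ => coeff d χ (j + 1) ψ * (χ (j + 1) y : ℂ)) (ψ y) := by
  have hd' : (d : ℂ) ≠ 0 := by exact_mod_cast hd.ne'
  refine (h.hasSum_odd hd hy hε).congr_fun fun j => ?_
  have hi : ∀ m : ℂ, IntervalIntegrable (fun y : ℝ =>
      Complex.exp (Complex.I * (m * (Real.pi * y / (2 * d)))) * ψ y) volume 0 d := fun m =>
    ((exp_mode_contDiff d m).continuous.mul h.contDiff.continuous).intervalIntegrable _ _
  have h1 : coeff d χ (j + 1) ψ =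
      κ * (∫ y in (0 : ℝ)..d, Complex.exp (Complex.I * ((2 * j + 1) *
        (Real.pi * y / (2 * d)))) * ψ y) +
      κ * ε * ∫ y in (0 : ℝ)..d, Complex.exp (Complex.I * (-(2 * j + 1) *
        (Real.pi * y / (2 * d)))) * ψ y := by
    rw [coeff, integral_crossMeasure_complex hd, ← intervalIntegral.integral_const_mul,
      ← intervalIntegral.integral_const_mul, ← intervalIntegral.integral_add]
    · refine intervalIntegral.integral_congr fun y _ => ?_
      simp only [hχ, neg_mul, mul_neg]
      ring
    · exact (hi _).const_mul _
    · exact (hi _).const_mul _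
  rw [h1, hχ, circleCoeff, circleCoeff]
  push_cast
  simp only [neg_neg]
  generalize (∫ y in (0 : ℝ)..d, Complex.exp (Complex.I * ((2 * j + 1) *
        (Real.pi * y / (2 * d)))) * ψ y) = P
  generalize (∫ y in (0 : ℝ)..d, Complex.exp (Complex.I * (-(2 * j + 1) *
        (Real.pi * y / (2 * d)))) * ψ y) = Q
  generalize Complex.exp (Complex.I * ((2 * j + 1) * (Real.pi * y / (2 * d)))) = z
  generalize Complex.exp (-(Complex.I * ((2 * j + 1) * (Real.pi * y / (2 * d))))) = w
  rw [← sub_eq_zero]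
  field_simp
  linear_combination 2 * (P + ε * Q) * (z + ε * w) * hκ + 2 * Q * (z + ε * w) * hε

lemma hasSum_chiMinus (h : IsCrossTest d ψ) (hd : 0 < d) {y : ℝ} (hy : y ∈ Ioo 0 d) :
    HasSum (fun j : ℕ => coeff d (chiMinus d) (j + 1) ψ * (chiMinus d (j + 1) y : ℂ)) (ψ y) := by
  have hd' : (d : ℂ) ≠ 0 := by exact_mod_cast hd.ne'
  have hs : ((Real.sqrt (2 / d) : ℝ) : ℂ) ^ 2 = 2 / d := by
    rw [← Complex.ofReal_pow, Real.sq_sqrt (by positivity)]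
    push_cast
    rfl
  refine h.hasSum_coeff_of_exp hd (ε := -1) (κ := -(Real.sqrt (2 / d) * Complex.I / 2))
    (by norm_num) ?_ (fun j y => ?_) hy
  · rw [neg_sq, div_pow, mul_pow, hs, Complex.I_sq]
    field_simp
  · rw [chiMinus]
    push_cast
    rw [Complex.sin]
    rw [show -((2 * ((j : ℂ) + 1) - 1) * (Real.pi * y / (2 * d))) * Complex.I =
      -(Complex.I * ((2 * j + 1) * (Real.pi * y / (2 * d)))) by ring,
      show ((2 * ((j : ℂ) + 1) - 1) * (Real.pi * y / (2 * d))) * Complex.I =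
      Complex.I * ((2 * j + 1) * (Real.pi * y / (2 * d))) by ring]
    ring

lemma hasSum_chiPlus (h : IsCrossTest d ψ) (hd : 0 < d) {y : ℝ} (hy : y ∈ Ioo 0 d) :
    HasSum (fun j : ℕ => coeff d (chiPlus d) (j + 1) ψ * (chiPlus d (j + 1) y : ℂ)) (ψ y) := by
  have hd' : (d : ℂ) ≠ 0 := by exact_mod_cast hd.ne'
  have hs : ((Real.sqrt (2 / d) : ℝ) : ℂ) ^ 2 = 2 / d := by
    rw [← Complex.ofReal_pow, Real.sq_sqrt (by positivity)]
    push_cast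
    rfl
  refine h.hasSum_coeff_of_exp hd (ε := 1) (κ := Real.sqrt (2 / d) / 2)
    (by norm_num) ?_ (fun j y => ?_) hy
  · rw [div_pow, hs]
    field_simp
  · rw [chiPlus]
    push_cast
    rw [Complex.cos]
    rw [show -((2 * ((j : ℂ) + 1) - 1) * (Real.pi * y / (2 * d))) * Complex.I =
      -(Complex.I * ((2 * j + 1) * (Real.pi * y / (2 * d)))) by ring,
      show ((2 * ((j : ℂ) + 1) - 1) * (Real.pi * y / (2 * d))) * Complex.I =
      Complex.I * ((2 * j + 1) * (Real.pi * y / (2 * d))) by ring]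
    ring

end IsCrossTest

lemma IsModeFamily.complex_contDiff {d : ℝ} {χ : ℕ → ℝ → ℝ} (hχ : IsModeFamily d χ) (n : ℕ) :
    ContDiff ℝ ∞ fun y => (χ n y : ℂ) :=
  Complex.ofRealCLM.contDiff.comp (hχ.contDiff n)

lemma IsModeFamily.complex_deriv_deriv {d : ℝ} {χ : ℕ → ℝ → ℝ} (hχ : IsModeFamily d χ) (n : ℕ)
    (y : ℝ) : deriv (deriv fun y => (χ n y : ℂ)) y = -(mu d n : ℂ) * (χ n y : ℂ) := by
  have h1 : deriv (fun y => (χ n y : ℂ)) = fun y => ((deriv (χ n) y : ℝ) : ℂ) := funext fun y =>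
    ((hχ.contDiff n).differentiable (by simp) y).hasDerivAt.ofReal_comp.deriv
  have h2 : ContDiff ℝ ∞ (deriv (χ n)) := (contDiff_infty_iff_deriv.1 (hχ.contDiff n)).2
  rw [h1, (h2.differentiable (by simp) y).hasDerivAt.ofReal_comp.deriv, hχ.deriv_deriv]
  push_cast
  rfl

namespace IsCrossTest

variable {d : ℝ} {ψ : ℝ → ℂ}

lemma exists_norm_coeff_le (h : IsCrossTest d ψ) (hd : 0 < d) {χ : ℕ → ℝ → ℝ}
    (hχ : IsModeFamily d χ) :
    ∃ K : ℝ, 0 ≤ K ∧ ∀ j : ℕ, ‖coeff d χ (j + 1) ψ‖ ≤ K / ((j : ℝ) + 1) ^ 2 := by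
  set K := Real.sqrt (2 / d) * ∫ y in (0 : ℝ)..d, ‖deriv (deriv ψ) y‖
  have hpi := Real.pi_pos
  have hK : 0 ≤ K := mul_nonneg (Real.sqrt_nonneg _)
    (intervalIntegral.integral_nonneg hd.le fun _ _ => norm_nonneg _)
  refine ⟨K / ((Real.pi / d) ^ 2 / 4), by positivity, fun j => ?_⟩
  have h1 := h.norm_mul_norm_integral_le hd (hχ.complex_contDiff (j + 1))
    (hχ.complex_deriv_deriv (j + 1)) (hχ.norm_le (j + 1))
  -- Uses n - 1/2 ≥ n/2 for n = j + 1 ≥ 1.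
  have h2 : ((j : ℝ) + 1) ^ 2 * ((Real.pi / d) ^ 2 / 4) ≤ ‖-(mu d (j + 1) : ℂ)‖ := by
    rw [norm_neg, Complex.norm_real, mu_eq]
    refine le_trans ?_ (le_abs_self _)
    have hj : (0 : ℝ) ≤ j := Nat.cast_nonneg j
    have : ((j : ℝ) + 1) ^ 2 / 4 ≤ (((j + 1 : ℕ) : ℝ) - 1 / 2) ^ 2 := by
      push_cast
      nlinarith
    calc _ = ((j : ℝ) + 1) ^ 2 / 4 * (Real.pi / d) ^ 2 := by ring
      _ ≤ _ := mul_le_mul_of_nonneg_right this (sq_nonneg _)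
  rw [coeff, integral_crossMeasure_complex hd, div_div, le_div_iff₀ (by positivity)]
  calc _ = ((j : ℝ) + 1) ^ 2 * ((Real.pi / d) ^ 2 / 4) *
        ‖∫ y in (0 : ℝ)..d, (χ (j + 1) y : ℂ) * ψ y‖ := by ring
    _ ≤ _ := (mul_le_mul_of_nonneg_right h2 (norm_nonneg _)).trans h1

/-- Quadratic decay makes the weighted squares O(n⁻³), and the pointwise expansion identifies the L²
sum. Completeness of the modes in L² is never needed. -/
lemma memSobolev_of_hasSum (h : IsCrossTest d ψ) (hd : 0 < d) {χ : ℕ → ℝ → ℝ}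
    (hχ : IsModeFamily d χ)
    (hs : ∀ y ∈ Ioo 0 d, HasSum (fun j : ℕ => coeff d χ (j + 1) ψ * (χ (j + 1) y : ℂ)) (ψ y)) :
    MemSobolev d χ (1 / 2) ψ := by
  obtain ⟨K, hK, hb⟩ := h.exists_norm_coeff_le hd hχ
  have hle : ∀ j : ℕ, ((j : ℝ) + 1) * ‖coeff d χ (j + 1) ψ‖ ^ 2 ≤
      K ^ 2 * (1 / ((j : ℝ) + 1) ^ 2) := fun j => by
    have hj : (1 : ℝ) ≤ (j : ℝ) + 1 := by linarith [(Nat.cast_nonneg j : (0 : ℝ) ≤ j)]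
    calc ((j : ℝ) + 1) * ‖coeff d χ (j + 1) ψ‖ ^ 2
        ≤ ((j : ℝ) + 1) * (K / ((j : ℝ) + 1) ^ 2) ^ 2 := by gcongr; exact hb j
      _ = K ^ 2 * (1 / ((j : ℝ) + 1) ^ 3) := by field_simp
      _ ≤ _ := by gcongr; norm_num
  have h2 : Summable fun j : ℕ => K ^ 2 * (1 / ((j : ℝ) + 1) ^ 2) := by
    refine Summable.mul_left _ ?_
    exact_mod_cast (summable_nat_add_iff 1).2 (Real.summable_one_div_nat_pow.2 one_lt_two)
  have h3 : Summable fun j : ℕ => ((j : ℝ) + 1) * ‖coeff d χ (j + 1) ψ‖ ^ 2 :=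
    Summable.of_nonneg_of_le (fun j => by positivity) hle h2
  have h4 : Summable fun j : ℕ => ‖coeff d χ (j + 1) ψ‖ ^ 2 :=
    Summable.of_nonneg_of_le (fun j => sq_nonneg _)
      (fun j => le_mul_of_one_le_left (sq_nonneg _)
        (by linarith [(Nat.cast_nonneg j : (0 : ℝ) ≤ j)])) h3
  have hm : Memℓp (fun j => coeff d χ (j + 1) ψ) 2 := memℓp_gen (by simpa using h4)
  exact hχ.memSobolev_of_ae_eq_synth (hχ.ae_eq_synth_of_hasSum ⟨_, hm⟩ hs) h3

/-- Test functions on the cross-section belong to `𝓗^{1/2}`. -/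
lemma memHHalf (h : IsCrossTest d ψ) (hd : 0 < d) : MemHHalf d ψ :=
  ⟨h.memSobolev_of_hasSum hd (isModeFamily_chiMinus hd) fun _ => h.hasSum_chiMinus hd,
    h.memSobolev_of_hasSum hd (isModeFamily_chiPlus hd) fun _ => h.hasSum_chiPlus hd⟩

end IsCrossTest

/-! ### Coercivity and the solution of the interface equation -/

/-- Lax–Milgram on V: the compression of M to V inherits the lower bound on the quadratic form and
is therefore invertible. -/
lemma exists_mem_forall_inner_eq {K : Type*} [NormedAddCommGroup K] [InnerProductSpace ℂ K]
    (V : Submodule ℂ K) [CompleteSpace V] (M : K →L[ℂ] K) {c : NNReal} (hc : 0 < c)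
    (hM : ∀ a, ‖a‖ ^ 2 * c ≤ ‖inner ℂ (M a) a‖) (h : K) :
    ∃ φ ∈ V, ∀ ψ ∈ V, inner ℂ (M φ) ψ = inner ℂ h ψ := by
  let T : V →L[ℂ] V := V.orthogonalProjectionOnto ∘L M ∘L V.subtypeL
  have hT : IsUnit T := by
    refine ContinuousLinearMap.isUnit_of_forall_le_norm_inner_map T hc fun x => ?_
    have : inner ℂ (T x) x = inner ℂ (M x) (x : K) :=
      Submodule.inner_orthogonalProjectionOnto_eq_of_mem_right x (M x)
    rw [this]
    exact hM x
  obtain ⟨φ, hφ⟩ := (ContinuousLinearMap.isUnit_iff_bijective.1 hT).2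
    (V.orthogonalProjectionOnto h)
  refine ⟨φ, φ.2, fun ψ hψ => ?_⟩
  have h1 := Submodule.inner_orthogonalProjectionOnto_eq_of_mem_right (⟨ψ, hψ⟩ : V) (M φ)
  have h2 := Submodule.inner_orthogonalProjectionOnto_eq_of_mem_right (⟨ψ, hψ⟩ : V) h
  rw [← h1, ← h2, ← hφ]
  rfl

lemma memlp_two_iff {a : ℕ → ℂ} : Memℓp a 2 ↔ Summable fun j => ‖a j‖ ^ 2 := by
  rw [memℓp_gen_iff (by norm_num)]
  simp

lemma summable_sq_lp (a : lp (fun _ : ℕ => ℂ) 2) : Summable fun j => ‖a j‖ ^ 2 :=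
  memlp_two_iff.1 (lp.memℓp a)

lemma memlp_mul {w : ℕ → ℂ} {C : ℝ} (hw : ∀ j, ‖w j‖ ≤ C) (a : lp (fun _ : ℕ => ℂ) 2) :
    Memℓp (fun j => w j * a j) 2 := by
  rw [memlp_two_iff]
  refine Summable.of_nonneg_of_le (fun j => sq_nonneg _) (fun j => ?_)
    ((summable_sq_lp a).mul_left (C ^ 2))
  rw [norm_mul, mul_pow]
  gcongr
  exact hw j

/-- The bounded diagonal operator on `ℓ²` with entries `w j`. -/
def diagonalOp (w : ℕ → ℂ) (C : ℝ) (hw : ∀ j, ‖w j‖ ≤ C) :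
    lp (fun _ : ℕ => ℂ) 2 →L[ℂ] lp (fun _ : ℕ => ℂ) 2 :=
  LinearMap.mkContinuous
    { toFun := fun a => ⟨fun j => w j * a j, memlp_mul hw a⟩
      map_add' := fun a b => by
        ext j
        exact mul_add _ _ _
      map_smul' := fun z a => by
        ext j
        exact mul_left_comm _ _ _ } C fun a => by
    have hC : 0 ≤ C := (norm_nonneg _).trans (hw 0)
    refine lp.norm_le_of_forall_sum_le (by norm_num) (by positivity) fun s => ?_
    rw [Real.mul_rpow hC (norm_nonneg _)]
    refine le_trans ?_ (mul_le_mul_of_nonneg_left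
      (lp.sum_rpow_le_norm_rpow (by norm_num) a s) (by positivity))
    rw [Finset.mul_sum]
    refine Finset.sum_le_sum fun j _ => ?_
    rw [← Real.mul_rpow hC (norm_nonneg _)]
    refine Real.rpow_le_rpow (norm_nonneg _) ?_ (by norm_num)
    show ‖w j * a j‖ ≤ _
    rw [norm_mul]
    exact mul_le_mul_of_nonneg_right (hw j) (norm_nonneg _)

lemma diagonalOp_apply (w : ℕ → ℂ) (C : ℝ) (hw : ∀ j, ‖w j‖ ≤ C) (a : lp (fun _ : ℕ => ℂ) 2)
    (j : ℕ) : diagonalOp w C hw a j = w j * a j := rfl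

/-- The inner product is antilinear in its first slot, so each term carries conj u, and Re((1 - i)
conj u) = Re u - Im u = 1. -/
lemma re_inner_diagonalOp {u : ℕ → ℂ} (hu : ∀ j, ‖u j‖ ≤ 1) (hre : ∀ j, (u j).re - (u j).im = 1)
    (a : lp (fun _ : ℕ => ℂ) 2) :
    ((1 - Complex.I) * inner ℂ (diagonalOp u 1 hu a) a).re = ‖a‖ ^ 2 := by
  have h1 := Complex.hasSum_re ((lp.hasSum_inner (𝕜 := ℂ) (diagonalOp u 1 hu a) a).mul_left
    (1 - Complex.I))
  have h2 := Complex.hasSum_re (lp.hasSum_inner (𝕜 := ℂ) a a)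
  have h3 : (inner ℂ a a : ℂ).re = ‖a‖ ^ 2 := by
    rw [inner_self_eq_norm_sq_to_K]
    norm_cast
  rw [h3] at h2
  refine (h1.congr_fun fun j => ?_).unique h2
  rw [diagonalOp_apply]
  have := hre j
  simp only [RCLike.inner_apply, map_mul, Complex.mul_re, Complex.mul_im, Complex.conj_re,
    Complex.conj_im, Complex.sub_re, Complex.sub_im, Complex.one_re, Complex.one_im,
    Complex.I_re, Complex.I_im]
  linear_combination (-((a j).re ^ 2 + (a j).im ^ 2)) * this

/-- Solvability of `∑ s_j (p_j^{(1)} + p_j^{(2)}) φ = b e_m` on the form domain, where `U₁`, `U₂`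
synthesize functions from their coefficients in two orthonormal systems. -/
lemma exists_form_solution {L : Type*} [NormedAddCommGroup L] [InnerProductSpace ℂ L]
    (U₁ U₂ : lp (fun _ : ℕ => ℂ) 2 →ₗᵢ[ℂ] L) {s : ℕ → ℂ} {c : ℝ} (hc : 0 < c)
    (hcs : ∀ j, c ≤ ‖s j‖) (hs : ∀ j, (s j).re - (s j).im = ‖s j‖) (m : ℕ) (b : ℂ) :
    ∃ a₁ a₂ : lp (fun _ : ℕ => ℂ) 2, U₁ a₁ = U₂ a₂ ∧
      (Summable fun j => ‖s j‖ * ‖a₁ j‖ ^ 2) ∧ (Summable fun j => ‖s j‖ * ‖a₂ j‖ ^ 2) ∧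
      ∀ b₁ b₂ : lp (fun _ : ℕ => ℂ) 2, U₁ b₁ = U₂ b₂ →
        (Summable fun j => ‖s j‖ * ‖b₁ j‖ ^ 2) → (Summable fun j => ‖s j‖ * ‖b₂ j‖ ^ 2) →
        HasSum (fun j => conj (s j * a₁ j) * b₁ j + conj (s j * a₂ j) * b₂ j)
          (conj b * b₁ m) := by
  have hpos : ∀ j, 0 < ‖s j‖ := fun j => hc.trans_le (hcs j)
  have hsq : ∀ j, 0 < Real.sqrt ‖s j‖ := fun j => Real.sqrt_pos.2 (hpos j)
  -- Multiplication by v = |s|^{1/2} maps the weighted sequence space onto ℓ²; `W` undoes it. In the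
  -- new coordinates the form is bounded and has the unimodular symbol s/|s|, which is the diagonal
  -- of `Δ`.
  let v : ℕ → ℂ := fun j => ((Real.sqrt ‖s j‖ : ℝ) : ℂ)
  have hv0 : ∀ j, v j ≠ 0 := fun j => Complex.ofReal_ne_zero.2 (hsq j).ne'
  have hvn : ∀ j, ‖v j‖ = Real.sqrt ‖s j‖ := fun j => by
    rw [Complex.norm_real, Real.norm_of_nonneg (hsq j).le]
  have hvsq : ∀ j, ‖v j‖ ^ 2 = ‖s j‖ := fun j => by rw [hvn, Real.sq_sqrt (hpos j).le]
  have hw : ∀ j, ‖(v j)⁻¹‖ ≤ (Real.sqrt c)⁻¹ := fun j => by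
    rw [norm_inv, hvn]
    exact inv_anti₀ (Real.sqrt_pos.2 hc) (Real.sqrt_le_sqrt (hcs j))
  let W := diagonalOp (fun j => (v j)⁻¹) _ hw
  have hW : ∀ a j, W a j = (v j)⁻¹ * a j := fun _ _ => rfl
  have hnn : ∀ j, ‖s j / (‖s j‖ : ℂ)‖ = 1 := fun j => by
    rw [norm_div, Complex.norm_real, norm_norm, div_self (hpos j).ne']
  have hu : ∀ j, ‖s j / (‖s j‖ : ℂ)‖ ≤ 1 := fun j => (hnn j).le
  have hure : ∀ j, (s j / (‖s j‖ : ℂ)).re - (s j / (‖s j‖ : ℂ)).im = 1 := fun j => by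
    rw [Complex.div_ofReal_re, Complex.div_ofReal_im, ← sub_div, hs, div_self (hpos j).ne']
  let Δ := diagonalOp _ 1 hu
  have hΔ : ∀ a j, Δ a j = s j / (‖s j‖ : ℂ) * a j := fun _ _ => rfl
  let K := WithLp 2 (lp (fun _ : ℕ => ℂ) 2 × lp (fun _ : ℕ => ℂ) 2)
  let e := WithLp.prodContinuousLinearEquiv 2 ℂ (lp (fun _ : ℕ => ℂ) 2) (lp (fun _ : ℕ => ℂ) 2)
  let M : K →L[ℂ] K := e.symm.toContinuousLinearMap ∘L (Δ.prodMap Δ) ∘L e.toContinuousLinearMap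
  -- The kernel of `G` encodes the form domain: both sequences must synthesize the same element of
  -- L.
  let G : K →L[ℂ] L := (U₁.toContinuousLinearMap ∘L W ∘L ContinuousLinearMap.fst ℂ _ _ -
    U₂.toContinuousLinearMap ∘L W ∘L ContinuousLinearMap.snd ℂ _ _) ∘L e.toContinuousLinearMap
  let V : Submodule ℂ K := LinearMap.ker G.toLinearMap
  have hVc : IsClosed (V : Set K) := G.isClosed_ker
  have hVcomp : CompleteSpace V := hVc.completeSpace_coe
  have hmemV : ∀ p : K, p ∈ V ↔ U₁ (W p.fst) = U₂ (W p.snd) := fun p => by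
    rw [LinearMap.mem_ker]
    exact sub_eq_zero
  have hMin : ∀ p q : K, inner ℂ (M p) q = inner ℂ (Δ p.fst) q.fst + inner ℂ (Δ p.snd) q.snd :=
    fun p q => rfl
  -- The constant 1/2 comes from the crude bound |1 - i| ≤ 2.
  have hcoer : ∀ p : K, ‖p‖ ^ 2 * ((1 / 2 : NNReal) : ℝ) ≤ ‖inner ℂ (M p) p‖ := fun p => by
    have h1 : ((1 - Complex.I) * inner ℂ (M p) p).re = ‖p‖ ^ 2 := by
      rw [hMin, mul_add, Complex.add_re, re_inner_diagonalOp hu hure, re_inner_diagonalOp hu hure,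
        WithLp.prod_norm_sq_eq_of_L2]
    have h2 : ‖(1 - Complex.I : ℂ)‖ ≤ 2 := by
      refine (norm_sub_le _ _).trans ?_
      simp
      norm_num
    have h3 : ‖p‖ ^ 2 ≤ 2 * ‖inner ℂ (M p) p‖ := by
      rw [← h1]
      refine (Complex.re_le_norm _).trans ?_
      rw [norm_mul]
      exact mul_le_mul_of_nonneg_right h2 (norm_nonneg _)
    push_cast
    linarith
  -- Test vectors have m-th coordinate v_m b₁(m), so dividing b by v_m produces conj b · b₁(m).
  obtain ⟨φ, hφV, hφ⟩ := exists_mem_forall_inner_eq V M (by positivity) hcoer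
    (WithLp.toLp 2 (lp.single 2 m (b / v m), 0))
  have hsum : ∀ a : lp (fun _ : ℕ => ℂ) 2, Summable fun j => ‖s j‖ * ‖W a j‖ ^ 2 := fun a => by
    refine (summable_sq_lp a).congr fun j => ?_
    rw [hW, norm_mul, mul_pow, norm_inv, inv_pow, hvsq, mul_inv_cancel_left₀ (hpos j).ne']
  refine ⟨W φ.fst, W φ.snd, (hmemV φ).1 hφV, hsum _, hsum _, fun b₁ b₂ hb hb₁ hb₂ => ?_⟩
  have hmem : ∀ {a : lp (fun _ : ℕ => ℂ) 2}, (Summable fun j => ‖s j‖ * ‖a j‖ ^ 2) →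
      Memℓp (fun j => v j * a j) 2 := fun ha => by
    rw [memlp_two_iff]
    refine ha.congr fun j => ?_
    rw [norm_mul, mul_pow, hvsq]
  let B₁ : lp (fun _ : ℕ => ℂ) 2 := ⟨_, hmem hb₁⟩
  let B₂ : lp (fun _ : ℕ => ℂ) 2 := ⟨_, hmem hb₂⟩
  have hB₁ : W B₁ = b₁ := by
    ext j
    exact inv_mul_cancel_left₀ (hv0 j) _
  have hB₂ : W B₂ = b₂ := by
    ext j
    exact inv_mul_cancel_left₀ (hv0 j) _
  have hBV : (WithLp.toLp 2 (B₁, B₂) : K) ∈ V := by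
    rw [hmemV]
    show U₁ (W B₁) = U₂ (W B₂)
    rw [hB₁, hB₂, hb]
  have h1 := hφ _ hBV
  rw [hMin] at h1
  have h2 : inner ℂ (WithLp.toLp 2 (lp.single 2 m (b / v m), 0) : K) (WithLp.toLp 2 (B₁, B₂) : K) =
      conj b * b₁ m := by
    rw [WithLp.prod_inner_apply]
    simp only [inner_zero_left, add_zero, lp.inner_single_left]
    show v m * b₁ m * conj (b / v m) = _
    have hcv : conj (v m) = v m := Complex.conj_ofReal _
    rw [map_div₀, hcv]
    field_simp [hv0 m]
  rw [h2] at h1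
  rw [← h1]
  have key : ∀ (a : lp (fun _ : ℕ => ℂ) 2) (z : ℂ) (j : ℕ),
      inner ℂ (Δ a j) (v j * z) = conj (s j * W a j) * z := fun a z j => by
    have hcv : conj (v j) = v j := Complex.conj_ofReal _
    have hvv : ((‖s j‖ : ℝ) : ℂ) = v j * v j := by
      rw [← Complex.ofReal_mul, Real.mul_self_sqrt (hpos j).le]
    rw [hΔ, hW, RCLike.inner_apply, hvv]
    simp only [map_mul, map_div₀, map_inv₀, hcv]
    field_simp [hv0 j]
  have hA := (lp.hasSum_inner (𝕜 := ℂ) (Δ φ.fst) B₁).add (lp.hasSum_inner (𝕜 := ℂ) (Δ φ.snd) B₂)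
  refine hA.congr_fun fun j => ?_
  rw [← key, ← key]

/-- The variational problem `D φ = c χ⁻_m` has a solution in `𝓗^{1/2}`. -/
lemma exists_DEqMode {d : ℝ} (hd : 0 < d) (n₀ : ℕ) (k : ℝ)
    (hthr : ∀ n : ℕ, 1 ≤ n → mu d n₀ + k ^ 2 ≠ mu d n) (b : ℂ) {m : ℕ} (hm : 1 ≤ m) :
    ∃ φ : ℝ → ℂ, MemHHalf d φ ∧ DEqMode d n₀ k φ b m := by
  have hM := isModeFamily_chiMinus hd
  have hP := isModeFamily_chiPlus hd
  obtain ⟨c, C, hc, hC, hb⟩ := exists_symbolD_bounds hd n₀ k hthr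
  have hle : ∀ j : ℕ, c ≤ ‖symbolD d n₀ k (j + 1)‖ := fun j =>
    (le_mul_of_one_le_right hc.le (by linarith [(Nat.cast_nonneg j : (0 : ℝ) ≤ j)])).trans (hb j).1
  -- The two-sided linear bounds on the symbol make the |s|-weighted summability used here
  -- equivalent to that of 𝓗^{1/2}. Mode m sits at coordinate m - 1.
  obtain ⟨a₁, a₂, ha, hs₁, hs₂, hsol⟩ := exists_form_solution hM.synth hP.synth hc hle
    (fun j => re_sub_im_symbolD d n₀ k (j + 1)) (m - 1) b
  have hsum : ∀ a : lp (fun _ : ℕ => ℂ) 2,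
      (Summable fun j => ‖symbolD d n₀ k (j + 1)‖ * ‖a j‖ ^ 2) →
      Summable fun j : ℕ => ((j : ℝ) + 1) * ‖a j‖ ^ 2 := fun a h => by
    refine Summable.of_nonneg_of_le (fun j => by positivity) (fun j => ?_) (h.mul_left c⁻¹)
    rw [← mul_assoc]
    refine mul_le_mul_of_nonneg_right ?_ (sq_nonneg _)
    rw [inv_mul_eq_div, le_div_iff₀ hc]
    linarith [(hb j).1]
  have hsum' : ∀ a : lp (fun _ : ℕ => ℂ) 2,
      (Summable fun j : ℕ => ((j : ℝ) + 1) * ‖a j‖ ^ 2) →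
      Summable fun j => ‖symbolD d n₀ k (j + 1)‖ * ‖a j‖ ^ 2 := fun a h => by
    refine Summable.of_nonneg_of_le (fun j => by positivity) (fun j => ?_) (h.mul_left C)
    rw [← mul_assoc]
    exact mul_le_mul_of_nonneg_right (hb j).2 (sq_nonneg _)
  have e₁ : (hM.synth a₁ : ℝ → ℂ) =ᵐ[crossMeasure d] hM.synth a₁ := EventuallyEq.rfl
  have e₂ : (hM.synth a₁ : ℝ → ℂ) =ᵐ[crossMeasure d] hP.synth a₂ := by rw [ha]
  refine ⟨hM.synth a₁, ⟨hM.memSobolev_of_ae_eq_synth e₁ (hsum _ hs₁),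
    hP.memSobolev_of_ae_eq_synth e₂ (hsum _ hs₂)⟩, fun ψ hψ => ?_⟩
  obtain ⟨b₁, hb₁, hsb₁⟩ := hM.exists_synth_of_memSobolev hψ.1
  obtain ⟨b₂, hb₂, hsb₂⟩ := hP.exists_synth_of_memSobolev hψ.2
  have h := hsol b₁ b₂ (Lp.ext (hb₁.symm.trans hb₂)) (hsum' _ hsb₁) (hsum' _ hsb₂)
  have hcm : coeff d (chiMinus d) m ψ = b₁ (m - 1) := by
    rw [← hM.coeff_of_ae_eq_synth hb₁, Nat.sub_add_cancel hm]
  rw [hcm]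
  simp_rw [hM.coeff_of_ae_eq_synth hb₁, hP.coeff_of_ae_eq_synth hb₂, hM.coeff_of_ae_eq_synth e₁,
    hP.coeff_of_ae_eq_synth e₂]
  exact h

/-! ### Outgoing fields: convergence, integrability and traces -/

lemma integrable_of_hasSum {α : Type*} [MeasurableSpace α] {μ : Measure α} {F : ℕ → α → ℂ}
    {g : α → ℂ} (hF : ∀ i, Integrable (F i) μ) (hs : Summable fun i => ∫ x, ‖F i x‖ ∂μ)
    (hg : ∀ᵐ x ∂μ, HasSum (fun i => F i x) (g x)) : Integrable g μ := by
  refine ⟨?_, ?_⟩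
  · refine aestronglyMeasurable_of_tendsto_ae atTop
      (f := fun (N : ℕ) x => ∑ i ∈ Finset.range N, F i x) (fun N => ?_) ?_
    · exact (integrable_finsetSum _ fun i _ => hF i).aestronglyMeasurable
    · filter_upwards [hg] with x hx using hx.tendsto_sum_nat
  · rw [hasFiniteIntegral_iff_enorm]
    calc ∫⁻ x, ‖g x‖ₑ ∂μ ≤ ∫⁻ x, ∑' i, ‖F i x‖ₑ ∂μ := by
          refine lintegral_mono_ae ?_
          filter_upwards [hg] with x hx
          rw [← hx.tsum_eq]
          exact enorm_tsum_le_tsum_enorm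
      _ = ∑' i, ENNReal.ofReal (∫ x, ‖F i x‖ ∂μ) := by
          rw [lintegral_tsum fun i => (hF i).aestronglyMeasurable.enorm]
          simp_rw [fun i => ofReal_integral_norm_eq_lintegral_enorm (hF i)]
      _ < ⊤ := hs.tsum_ofReal_lt_top

/-- Exponents with nonnegative real part that grows linearly. -/
structure IsDecayRate (σ : ℕ → ℂ) : Prop where
  re_nonneg : ∀ j, 0 ≤ (σ j).re
  growth : ∃ c B : ℝ, 0 < c ∧ ∀ j : ℕ, c * ((j : ℝ) + 1) - B ≤ (σ j).re

lemma isDecayRate_symbolD {d : ℝ} (hd : 0 < d) (n₀ : ℕ) (k : ℝ)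
    (hthr : ∀ n : ℕ, 1 ≤ n → mu d n₀ + k ^ 2 ≠ mu d n) :
    IsDecayRate fun j => symbolD d n₀ k (j + 1) :=
  ⟨fun _ => symbolD_re_nonneg _ _ _ _, exists_le_symbolD_re hd n₀ k hthr⟩

/-- The outgoing wave in mode `j + 1` with amplitude `a j`. -/
def modeTerm (χ : ℕ → ℝ → ℝ) (σ a : ℕ → ℂ) (j : ℕ) (p : ℝ × ℝ) : ℂ :=
  a j * Complex.exp (-(σ j * |p.1|)) * χ (j + 1) p.2

/-- The superposition of the outgoing waves with amplitudes `a j`. -/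
def modeField (χ : ℕ → ℝ → ℝ) (σ a : ℕ → ℂ) (p : ℝ × ℝ) : ℂ := ∑' j, modeTerm χ σ a j p

lemma norm_exp_neg_mul_abs (z : ℂ) (x : ℝ) :
    ‖Complex.exp (-(z * |x|))‖ = Real.exp (-(z.re * |x|)) := by
  rw [Complex.norm_exp]
  simp

section

variable {d : ℝ} {χ : ℕ → ℝ → ℝ} {σ : ℕ → ℂ}

lemma continuous_modeTerm (hχ : IsModeFamily d χ) (σ a : ℕ → ℂ) (j : ℕ) :
    Continuous (modeTerm χ σ a j) := by
  have h1 : Continuous fun p : ℝ × ℝ => (χ (j + 1) p.2 : ℂ) :=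
    (hχ.continuous_ofReal (j + 1)).comp continuous_snd
  have h2 : Continuous fun p : ℝ × ℝ => a j * Complex.exp (-(σ j * |p.1|)) := by fun_prop
  exact h2.mul h1

lemma norm_modeTerm_le (hχ : IsModeFamily d χ) (σ a : ℕ → ℂ) (j : ℕ) (p : ℝ × ℝ) :
    ‖modeTerm χ σ a j p‖ ≤ ‖a j‖ * Real.exp (-((σ j).re * |p.1|)) * Real.sqrt (2 / d) := by
  rw [modeTerm, norm_mul, norm_mul, norm_exp_neg_mul_abs]
  exact mul_le_mul_of_nonneg_left (hχ.norm_le _ _) (by positivity)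

/-- Away from x = 0 the amplitudes are bounded and the exponentials are dominated by a geometric
sequence of ratio e^{-c|x|}. -/
lemma summable_norm_mul_exp (hσ : IsDecayRate σ) (a : lp (fun _ : ℕ => ℂ) 2) {x : ℝ}
    (hx : x ≠ 0) : Summable fun j => ‖a j‖ * Real.exp (-((σ j).re * |x|)) := by
  obtain ⟨c, B, hc, hg⟩ := hσ.growth
  have hx' : 0 < |x| := abs_pos.2 hx
  have hgeo : Summable fun j : ℕ =>
      ‖a‖ * (Real.exp ((B - c) * |x|) * Real.exp (-(c * |x|)) ^ j) :=
    ((summable_geometric_of_lt_one (Real.exp_pos _).le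
      (by rw [Real.exp_lt_one_iff]; nlinarith)).mul_left _).mul_left _
  refine Summable.of_nonneg_of_le (fun j => by positivity) (fun j => ?_) hgeo
  refine mul_le_mul (lp.norm_apply_le_norm (by norm_num) a j) ?_ (Real.exp_pos _).le
    (norm_nonneg _)
  rw [← Real.exp_nat_mul, ← Real.exp_add, Real.exp_le_exp]
  have := mul_le_mul_of_nonneg_right (hg j) hx'.le
  linarith

lemma hasSum_modeField (hχ : IsModeFamily d χ) (hσ : IsDecayRate σ)
    (a : lp (fun _ : ℕ => ℂ) 2) {p : ℝ × ℝ} (hp : p.1 ≠ 0) :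
    HasSum (fun j => modeTerm χ σ a j p) (modeField χ σ a p) :=
  (Summable.of_norm_bounded ((summable_norm_mul_exp hσ a hp).mul_right _)
    (norm_modeTerm_le hχ σ a · p)).hasSum

lemma integral_exp_neg_mul_abs_le {ρ R : ℝ} (hρ : 0 < ρ) :
    ∫ x in Ioo (-R) R, Real.exp (-(ρ * |x|)) ≤ 2 / ρ := by
  have h2 := integral_exp_mul_Ioi (neg_lt_zero.2 hρ) 0
  simp only [neg_mul, mul_zero, Real.exp_zero] at h2
  have h3 : ∫ x : ℝ, Real.exp (-(ρ * |x|)) = 2 / ρ := by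
    rw [integral_comp_abs (f := fun x => Real.exp (-(ρ * x))), h2]
    field_simp
  -- A function that is not integrable has integral zero by convention, so the computed nonzero
  -- value gives integrability.
  have hint : Integrable (fun x : ℝ => Real.exp (-(ρ * |x|))) :=
    Integrable.of_integral_ne_zero (by rw [h3]; positivity)
  exact (setIntegral_le_integral hint
    (Eventually.of_forall fun x => (Real.exp_pos _).le)).trans h3.le

/-- Bounded pieces of the waveguide. -/
def box (d R : ℝ) : Set (ℝ × ℝ) := Ioo (-R) R ×ˢ Ioo 0 d

lemma measurableSet_box (d R : ℝ) : MeasurableSet (box d R) :=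
  measurableSet_Ioo.prod measurableSet_Ioo

lemma integrableOn_box {g : ℝ × ℝ → ℂ} (hg : Continuous g) (d R : ℝ) :
    IntegrableOn g (box d R) :=
  (hg.continuousOn.integrableOn_compact (isCompact_Icc.prod isCompact_Icc)).mono_set
    (prod_mono Ioo_subset_Icc_self Ioo_subset_Icc_self)

/-- Integrating the decay in x gains 1/(j + 1), which makes square-summable amplitudes enough for
absolute summability in L¹. The shift B in the growth bound costs only e^{|B|R} on a bounded piece.
-/
lemma integral_norm_modeTerm_le (hχ : IsModeFamily d χ) (hd : 0 < d) (hσ : IsDecayRate σ) (R : ℝ) :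
    ∃ K : ℝ, ∀ (a : ℕ → ℂ) (j : ℕ),
      ∫ p in box d R, ‖modeTerm χ σ a j p‖ ≤ K * (‖a j‖ * (1 / ((j : ℝ) + 1))) := by
  obtain ⟨c, B, hc, hg⟩ := hσ.growth
  refine ⟨Real.exp (|B| * R) * Real.sqrt (2 / d) * (2 / c) * d, fun a j => ?_⟩
  have hj : (0 : ℝ) < (j : ℝ) + 1 := by positivity
  have hle : ∀ p ∈ box d R, ‖modeTerm χ σ a j p‖ ≤
      (‖a j‖ * Real.exp (|B| * R) * Real.sqrt (2 / d)) *
        (Real.exp (-(c * ((j : ℝ) + 1) * |p.1|)) * 1) := fun p hp => by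
    refine (norm_modeTerm_le hχ σ a j p).trans ?_
    have h1 : Real.exp (-((σ j).re * |p.1|)) ≤
        Real.exp (|B| * R) * Real.exp (-(c * ((j : ℝ) + 1) * |p.1|)) := by
      rw [← Real.exp_add, Real.exp_le_exp]
      have h2 := mul_le_mul_of_nonneg_right (hg j) (abs_nonneg p.1)
      have h3 : |p.1| ≤ R := (abs_lt.2 hp.1).le
      have h4 : B * |p.1| ≤ |B| * R :=
        mul_le_mul (le_abs_self B) h3 (abs_nonneg _) (abs_nonneg _)
      linarith
    calc _ ≤ ‖a j‖ * (Real.exp (|B| * R) * Real.exp (-(c * ((j : ℝ) + 1) * |p.1|))) *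
          Real.sqrt (2 / d) := by gcongr
      _ = _ := by ring
  have hcont : Continuous fun p : ℝ × ℝ => (‖a j‖ * Real.exp (|B| * R) * Real.sqrt (2 / d)) *
        (Real.exp (-(c * ((j : ℝ) + 1) * |p.1|)) * 1) := by fun_prop
  calc ∫ p in box d R, ‖modeTerm χ σ a j p‖
      ≤ ∫ p in box d R, (‖a j‖ * Real.exp (|B| * R) * Real.sqrt (2 / d)) *
        (Real.exp (-(c * ((j : ℝ) + 1) * |p.1|)) * 1) := by
        refine setIntegral_mono_on (integrableOn_box (continuous_modeTerm hχ σ a j) d R).norm ?_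
          (measurableSet_box d R) hle
        exact (hcont.continuousOn.integrableOn_compact
          (isCompact_Icc.prod isCompact_Icc)).mono_set
          (prod_mono Ioo_subset_Icc_self Ioo_subset_Icc_self)
    _ = (‖a j‖ * Real.exp (|B| * R) * Real.sqrt (2 / d)) *
        ((∫ x in Ioo (-R) R, Real.exp (-(c * ((j : ℝ) + 1) * |x|))) * d) := by
        rw [integral_const_mul, box, Measure.volume_eq_prod,
          setIntegral_prod_mul (fun x : ℝ => Real.exp (-(c * ((j : ℝ) + 1) * |x|)))
            (fun _ : ℝ => (1 : ℝ))]
        simp [hd.le]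
    _ ≤ (‖a j‖ * Real.exp (|B| * R) * Real.sqrt (2 / d)) * ((2 / (c * ((j : ℝ) + 1))) * d) := by
        gcongr
        exact integral_exp_neg_mul_abs_le (by positivity)
    _ = _ := by field_simp

lemma summable_integral_norm_modeTerm (hχ : IsModeFamily d χ) (hd : 0 < d) (hσ : IsDecayRate σ)
    (a : lp (fun _ : ℕ => ℂ) 2) (R : ℝ) :
    Summable fun j => ∫ p in box d R, ‖modeTerm χ σ a j p‖ := by
  obtain ⟨K, hK⟩ := integral_norm_modeTerm_le hχ hd hσ R
  have h2 : Summable fun j : ℕ => (1 / ((j : ℝ) + 1)) ^ 2 := by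
    have := (summable_nat_add_iff 1).2 (Real.summable_one_div_nat_pow.2 one_lt_two)
    simpa using this
  have h3 : Summable fun j : ℕ => ‖a j‖ * (1 / ((j : ℝ) + 1)) := by
    refine Summable.of_nonneg_of_le (fun j => by positivity) (fun j => ?_)
      ((summable_sq_lp a).add h2)
    nlinarith [sq_nonneg (‖a j‖ - 1 / ((j : ℝ) + 1)), sq_nonneg ‖a j‖,
      sq_nonneg (1 / ((j : ℝ) + 1))]
  exact Summable.of_nonneg_of_le (fun j => integral_nonneg fun _ => norm_nonneg _)
    (fun j => hK a j) (h3.mul_left K)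

lemma ae_fst_ne_zero (s : Set (ℝ × ℝ)) : ∀ᵐ p ∂((volume : Measure (ℝ × ℝ)).restrict s), p.1 ≠ 0 := by
  refine ae_restrict_of_ae ?_
  rw [Measure.volume_eq_prod]
  exact Measure.quasiMeasurePreserving_fst.ae (Measure.ae_ne volume 0)

lemma integrableOn_modeField (hχ : IsModeFamily d χ) (hd : 0 < d) (hσ : IsDecayRate σ)
    (a : lp (fun _ : ℕ => ℂ) 2) (R : ℝ) :
    IntegrableOn (modeField χ σ a) (box d R) := by
  refine integrable_of_hasSum (F := modeTerm χ σ a)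
    (fun j => integrableOn_box (continuous_modeTerm hχ σ a j) d R)
    (summable_integral_norm_modeTerm hχ hd hσ a R) ?_
  filter_upwards [ae_fst_ne_zero (box d R)] with p hp
  exact hasSum_modeField hχ hσ a hp

lemma hasSum_integral_modeField (hχ : IsModeFamily d χ) (hd : 0 < d) (hσ : IsDecayRate σ)
    (a : lp (fun _ : ℕ => ℂ) 2) (R : ℝ) {s : Set (ℝ × ℝ)} (hs : s ⊆ box d R)
    {G : ℝ × ℝ → ℂ} (hG : Continuous G) {C : ℝ} (hC : ∀ p, ‖G p‖ ≤ C) :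
    HasSum (fun j => ∫ p in s, modeTerm χ σ a j p * G p) (∫ p in s, modeField χ σ a p * G p) := by
  have hint : ∀ j, IntegrableOn (fun p => modeTerm χ σ a j p * G p) (box d R) := fun j =>
    integrableOn_box ((continuous_modeTerm hχ σ a j).mul hG) d R
  have hsum : Summable fun j => ∫ p in s, ‖modeTerm χ σ a j p * G p‖ := by
    refine Summable.of_nonneg_of_le (fun j => integral_nonneg fun _ => norm_nonneg _) (fun j => ?_)
      ((summable_integral_norm_modeTerm hχ hd hσ a R).mul_right C)
    refine (setIntegral_mono_set (hint j).norm (Eventually.of_forall fun _ => norm_nonneg _)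
      hs.eventuallyLE).trans ?_
    rw [← integral_mul_const]
    refine integral_mono (hint j).norm
      ((integrableOn_box (continuous_modeTerm hχ σ a j) d R).norm.mul_const C) fun p => ?_
    simp only [norm_mul]
    exact mul_le_mul_of_nonneg_left (hC p) (norm_nonneg _)
  have h := hasSum_integral_of_summable_integral_norm (μ := volume.restrict s)
    (F := fun j p => modeTerm χ σ a j p * G p) (fun j => (hint j).mono_set hs) hsum
  have he : ∫ p in s, modeField χ σ a p * G p =
      ∫ p in s, ∑' j, modeTerm χ σ a j p * G p := by
    refine integral_congr_ae ?_
    filter_upwards [ae_fst_ne_zero s] with p hp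
    exact ((hasSum_modeField hχ hσ a hp).mul_right (G p)).tsum_eq.symm
  rw [he]
  exact h

/-- The outgoing field attains its boundary value at `x = 0` in `L²(0,d)`. -/
lemma tendsto_modeField (hχ : IsModeFamily d χ) (hσ : IsDecayRate σ)
    (a : lp (fun _ : ℕ => ℂ) 2) {φ : ℝ → ℂ} (hφ : φ =ᵐ[crossMeasure d] hχ.synth a) :
    Tendsto (fun x : ℝ => eLpNorm (fun y => modeField χ σ a (x, y) - φ y) 2 (crossMeasure d))
      (𝓝[≠] 0) (𝓝 0) := by
  have hexp : ∀ (x : ℝ) (j : ℕ), ‖Complex.exp (-(σ j * |x|))‖ ≤ 1 := fun x j => by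
    rw [norm_exp_neg_mul_abs, Real.exp_le_one_iff, neg_nonpos]
    exact mul_nonneg (hσ.re_nonneg j) (abs_nonneg x)
  let A : ℝ → lp (fun _ : ℕ => ℂ) 2 := fun x =>
    diagonalOp (fun j => Complex.exp (-(σ j * |x|))) 1 (hexp x) a
  have hA : ∀ x j, A x j = Complex.exp (-(σ j * |x|)) * a j := fun _ _ => rfl
  have hnormsq : ∀ b : lp (fun _ : ℕ => ℂ) 2, ‖b‖ ^ 2 = ∑' j, ‖b j‖ ^ 2 := fun b => by
    have := lp.norm_rpow_eq_tsum (p := 2) (by norm_num) b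
    simpa using this
  have hlim : Tendsto (fun x : ℝ => ‖A x - a‖ ^ 2) (𝓝 0) (𝓝 0) := by
    simp_rw [hnormsq]
    suffices h : Tendsto (fun x : ℝ => ∑' j, ‖(A x - a) j‖ ^ 2) (𝓝 0) (𝓝 (∑' _ : ℕ, (0 : ℝ))) by
      rwa [tsum_zero] at h
    -- Each exponential tends to 1 and has modulus at most 1, so |e - 1|²|a_j|² ≤ 4|a_j|².
    refine tendsto_tsum_of_dominated_convergence (bound := fun j => 4 * ‖a j‖ ^ 2)
      ((summable_sq_lp a).mul_left 4) (fun j => ?_) (Eventually.of_forall fun x j => ?_)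
    · have hc : Continuous fun x : ℝ => ‖Complex.exp (-(σ j * |x|)) * a j - a j‖ ^ 2 := by
        fun_prop
      have := hc.tendsto 0
      simp only [abs_zero, Complex.ofReal_zero, mul_zero, neg_zero, Complex.exp_zero, one_mul,
        sub_self, norm_zero, ne_eq, OfNat.ofNat_ne_zero, not_false_eq_true, zero_pow] at this
      exact this
    · rw [lp.coeFn_sub, Pi.sub_apply, hA, Real.norm_of_nonneg (sq_nonneg _)]
      have h1 : ‖Complex.exp (-(σ j * |x|)) * a j - a j‖ ≤ 2 * ‖a j‖ := by
        refine (norm_sub_le _ _).trans ?_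
        rw [norm_mul]
        linarith [mul_le_mul_of_nonneg_right (hexp x j) (norm_nonneg (a j))]
      calc _ ≤ (2 * ‖a j‖) ^ 2 := by
            exact pow_le_pow_left₀ (norm_nonneg _) h1 2
        _ = _ := by ring
  have hlim2 : Tendsto (fun x : ℝ => ‖A x - a‖ₑ) (𝓝 0) (𝓝 0) := by
    have h1 : Tendsto (fun x : ℝ => ‖A x - a‖) (𝓝 0) (𝓝 0) := by
      have := hlim.sqrt
      simpa [Real.sqrt_sq] using this
    have h2 := ENNReal.tendsto_ofReal h1
    simpa using h2
  refine (hlim2.mono_left nhdsWithin_le_nhds).congr' ?_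
  filter_upwards [self_mem_nhdsWithin] with x hx
  have h1 : (fun y => modeField χ σ a (x, y)) =ᵐ[crossMeasure d] hχ.synth (A x) := by
    refine hχ.ae_eq_synth_of_hasSum (A x) fun y _ => ?_
    refine (hasSum_modeField hχ hσ a (p := (x, y)) hx).congr_fun fun j => ?_
    rw [hA, modeTerm]
    ring
  rw [← hχ.synth.enorm_map (A x - a), Lp.enorm_def, map_sub]
  refine eLpNorm_congr_ae ?_
  filter_upwards [Lp.coeFn_sub (hχ.synth (A x)) (hχ.synth a), h1, hφ] with y e1 e2 e3
  rw [e1, Pi.sub_apply, ← e2, ← e3]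

/-- Parseval's identity for the pairing of a mode expansion with a function in `L²(0,d)`. -/
lemma hasSum_mul_coeff (hχ : IsModeFamily d χ) {a : lp (fun _ : ℕ => ℂ) 2} {φ g : ℝ → ℂ}
    (hφ : φ =ᵐ[crossMeasure d] hχ.synth a) (hg : MemLp g 2 (crossMeasure d)) :
    HasSum (fun j => a j * coeff d χ (j + 1) g) (∫ y, φ y * g y ∂(crossMeasure d)) := by
  -- The pairing is bilinear, so the conjugate of g goes into the antilinear slot of the inner
  -- product.
  have hg' : MemLp (fun y => conj (g y)) 2 (crossMeasure d) := hg.star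
  have h1 := (hχ.hasSum_synth a).mapL (innerSL ℂ (hg'.toLp _))
  have h2 : innerSL ℂ (hg'.toLp _) (hχ.synth a) = ∫ y, φ y * g y ∂(crossMeasure d) := by
    rw [innerSL_apply_apply, L2.inner_def]
    refine integral_congr_ae ?_
    filter_upwards [hg'.coeFn_toLp, hφ] with y e1 e2
    rw [e1, e2]
    simp
  rw [h2] at h1
  refine h1.congr_fun fun j => ?_
  rw [map_smul, innerSL_apply_apply, ← inner_conj_symm, hχ.inner_modeLp_toLp, smul_eq_mul, coeff,
    coeff, ← integral_conj]
  simp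

end

/-! ### Green's identity in the strip -/

/-- The derivative of `v` in the direction `e`. -/
def dirDeriv (e : ℝ × ℝ) (v : ℝ × ℝ → ℂ) (p : ℝ × ℝ) : ℂ := fderiv ℝ v p e

lemma contDiff_dirDeriv {v : ℝ × ℝ → ℂ} (hv : ContDiff ℝ ∞ v) (e : ℝ × ℝ) :
    ContDiff ℝ ∞ (dirDeriv e v) :=
  (hv.fderiv_right (m := ∞) (by simp)).clm_apply contDiff_const

lemma deriv_slice_fst {v : ℝ × ℝ → ℂ} (hv : ContDiff ℝ ∞ v) (x y : ℝ) :
    deriv (fun s => v (s, y)) x = dirDeriv (1, 0) v (x, y) :=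
  ((hv.differentiable (by simp) (x, y)).hasFDerivAt.comp_hasDerivAt x
    ((hasDerivAt_id x).prodMk (hasDerivAt_const x y))).deriv

lemma deriv_slice_snd {v : ℝ × ℝ → ℂ} (hv : ContDiff ℝ ∞ v) (x y : ℝ) :
    deriv (fun s => v (x, s)) y = dirDeriv (0, 1) v (x, y) :=
  ((hv.differentiable (by simp) (x, y)).hasFDerivAt.comp_hasDerivAt y
    ((hasDerivAt_const y x).prodMk (hasDerivAt_id y))).deriv

lemma deriv_deriv_slice_fst {v : ℝ × ℝ → ℂ} (hv : ContDiff ℝ ∞ v) (x y : ℝ) :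
    deriv (deriv fun s => v (s, y)) x = dirDeriv (1, 0) (dirDeriv (1, 0) v) (x, y) := by
  rw [funext fun s => deriv_slice_fst hv s y, deriv_slice_fst (contDiff_dirDeriv hv _)]

lemma deriv_deriv_slice_snd {v : ℝ × ℝ → ℂ} (hv : ContDiff ℝ ∞ v) (x y : ℝ) :
    deriv (deriv fun s => v (x, s)) y = dirDeriv (0, 1) (dirDeriv (0, 1) v) (x, y) := by
  rw [funext fun s => deriv_slice_snd hv x s, deriv_slice_snd (contDiff_dirDeriv hv _)]

lemma iteratedDeriv_two_eq (u : ℝ → ℂ) : iteratedDeriv 2 u = deriv (deriv u) := by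
  rw [iteratedDeriv_succ, iteratedDeriv_one]

lemma lap_eq {v : ℝ × ℝ → ℂ} (hv : ContDiff ℝ ∞ v) (p : ℝ × ℝ) :
    lap v p = dirDeriv (1, 0) (dirDeriv (1, 0) v) p + dirDeriv (0, 1) (dirDeriv (0, 1) v) p := by
  rw [lap, iteratedDeriv_two_eq, iteratedDeriv_two_eq,
    deriv_deriv_slice_fst hv, deriv_deriv_slice_snd hv]

lemma tsupport_dirDeriv_subset (v : ℝ × ℝ → ℂ) (e : ℝ × ℝ) :
    tsupport (dirDeriv e v) ⊆ tsupport v := by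
  refine subset_trans (closure_mono fun p hp => ?_) (tsupport_fderiv_subset ℝ)
  refine Function.mem_support.2 fun h => hp ?_
  simp [dirDeriv, h]

lemma contDiff_slice_fst {v : ℝ × ℝ → ℂ} (hv : ContDiff ℝ ∞ v) (y : ℝ) :
    ContDiff ℝ ∞ fun s => v (s, y) :=
  hv.comp (contDiff_id.prodMk contDiff_const)

lemma isCrossTest_slice {d : ℝ} {v : ℝ × ℝ → ℂ} (hv : ContDiff ℝ ∞ v)
    (hs : tsupport v ⊆ strip d) (x : ℝ) : IsCrossTest d fun y => v (x, y) where
  contDiff := hv.comp (contDiff_const.prodMk contDiff_id)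
  tsupport_subset y hy := by
    have hc : Continuous fun y : ℝ => (x, y) := by fun_prop
    exact (hs (tsupport_comp_subset_preimage v hc hy)).2

lemma exp_contDiff (τ : ℂ) : ContDiff ℝ ∞ fun x : ℝ => Complex.exp (τ * x) := by
  have : ContDiff ℝ ∞ (fun y : ℝ => (y : ℂ)) := Complex.ofRealCLM.contDiff
  fun_prop

lemma exp_deriv (τ : ℂ) : deriv (fun x : ℝ => Complex.exp (τ * x)) =
    fun x : ℝ => τ * Complex.exp (τ * x) := by
  funext x
  have h := (((hasDerivAt_id x).ofReal_comp).const_mul τ).cexp.deriv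
  simp only [id] at h
  rw [h]
  push_cast
  ring

lemma exp_deriv_deriv (τ : ℂ) (x : ℝ) : deriv (deriv fun x : ℝ => Complex.exp (τ * x)) x =
    τ ^ 2 * Complex.exp (τ * x) := by
  rw [exp_deriv, deriv_const_mul_field, exp_deriv]
  ring

/-- Green's identity for a single mode on a piece of the waveguide. -/
lemma integral_mode_mul_helmholtz {d : ℝ} (hd : 0 < d) {χ : ℕ → ℝ → ℝ} (hχ : IsModeFamily d χ)
    (n : ℕ) {τ : ℂ} {E : ℝ} (hτ : τ ^ 2 = ((mu d n - E : ℝ) : ℂ)) {v : ℝ × ℝ → ℂ}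
    (hv : ContDiff ℝ ∞ v) (hs : tsupport v ⊆ strip d) {a b : ℝ} (hab : a ≤ b) :
    ∫ p in Ioo a b ×ˢ Ioo 0 d, Complex.exp (τ * p.1) * (χ n p.2 : ℂ) * (lap v p + E * v p) =
      Complex.exp (τ * b) * (coeff d χ n (fun y => dirDeriv (1, 0) v (b, y)) -
        τ * coeff d χ n (fun y => v (b, y))) -
      Complex.exp (τ * a) * (coeff d χ n (fun y => dirDeriv (1, 0) v (a, y)) -
        τ * coeff d χ n (fun y => v (a, y))) := by
  have hχc := hχ.complex_contDiff n
  have hvxx := contDiff_dirDeriv (contDiff_dirDeriv hv (1, 0)) (1, 0)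
  have hvyy := contDiff_dirDeriv (contDiff_dirDeriv hv (0, 1)) (0, 1)
  have hvx := contDiff_dirDeriv hv (1, 0)
  have hexp : Continuous fun p : ℝ × ℝ => Complex.exp (τ * p.1) := by fun_prop
  have hχ2 : Continuous fun p : ℝ × ℝ => (χ n p.2 : ℂ) := hχc.continuous.comp continuous_snd
  -- Since τ² = μ_n - E, the integrand splits into an exact x-derivative and an exact y-derivative.
  -- The latter integrates to zero because v vanishes near the walls y = 0 and y = d.
  let F₁ : ℝ × ℝ → ℂ := fun p => χ n p.2 * (Complex.exp (τ * p.1) *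
    dirDeriv (1, 0) (dirDeriv (1, 0) v) p - τ ^ 2 * Complex.exp (τ * p.1) * v p)
  let F₂ : ℝ × ℝ → ℂ := fun p => Complex.exp (τ * p.1) * (χ n p.2 *
    dirDeriv (0, 1) (dirDeriv (0, 1) v) p - -(mu d n : ℂ) * χ n p.2 * v p)
  have hF₁ : Continuous F₁ := hχ2.mul
    ((hexp.mul hvxx.continuous).sub ((continuous_const.mul hexp).mul hv.continuous))
  have hF₂ : Continuous F₂ := hexp.mul
    ((hχ2.mul hvyy.continuous).sub ((continuous_const.mul hχ2).mul hv.continuous))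
  have hint : ∀ {F : ℝ × ℝ → ℂ}, Continuous F → IntegrableOn F (Ioo a b ×ˢ Ioo 0 d)
      (volume.prod volume) := fun hF => by
    rw [← Measure.volume_eq_prod]
    exact (hF.continuousOn.integrableOn_compact (isCompact_Icc.prod isCompact_Icc)).mono_set
      (prod_mono Ioo_subset_Icc_self Ioo_subset_Icc_self)
  have hsplit : ∀ p : ℝ × ℝ, Complex.exp (τ * p.1) * (χ n p.2 : ℂ) * (lap v p + E * v p) =
      F₁ p + F₂ p := fun p => by
    simp only [F₁, F₂]
    rw [lap_eq hv, hτ]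
    push_cast
    ring
  have h₂ : ∫ p in Ioo a b ×ˢ Ioo 0 d, F₂ p ∂(volume.prod volume) = 0 := by
    rw [setIntegral_prod _ (hint hF₂)]
    refine integral_eq_zero_of_ae (Eventually.of_forall fun x => ?_)
    have ht := isCrossTest_slice hv hs x
    have hg := integral_green hχc ht.contDiff 0 d
    have h0 : (0 : ℝ) ∉ Ioo 0 d := by simp
    have hdd : d ∉ Ioo 0 d := by simp
    rw [ht.eq_zero h0, ht.eq_zero hdd, ht.deriv_eq_zero h0, ht.deriv_eq_zero hdd] at hg
    simp only [mul_zero, sub_self] at hg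
    simp only [F₂, Pi.zero_apply]
    rw [integral_const_mul, ← integral_Ioc_eq_integral_Ioo,
      ← intervalIntegral.integral_of_le hd.le]
    simp_rw [hχ.complex_deriv_deriv, deriv_deriv_slice_snd hv] at hg
    rw [hg, mul_zero]
  have h₁ : ∫ p in Ioo a b ×ˢ Ioo 0 d, F₁ p ∂(volume.prod volume) =
      ∫ y in Ioo 0 d, ((χ n y : ℂ) *
        ((Complex.exp (τ * b) * dirDeriv (1, 0) v (b, y) -
            τ * Complex.exp (τ * b) * v (b, y)) -
          (Complex.exp (τ * a) * dirDeriv (1, 0) v (a, y) -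
            τ * Complex.exp (τ * a) * v (a, y)))) := by
    have hi := hint hF₁
    rw [IntegrableOn, ← Measure.prod_restrict] at hi
    rw [← Measure.prod_restrict, integral_prod_symm _ hi]
    refine integral_congr_ae (Eventually.of_forall fun y => ?_)
    have hg := integral_green (exp_contDiff τ) (contDiff_slice_fst hv y) a b
    simp_rw [exp_deriv_deriv, deriv_deriv_slice_fst hv, deriv_slice_fst hv, exp_deriv] at hg
    simp only [F₁]
    rw [integral_const_mul, ← integral_Ioc_eq_integral_Ioo,
      ← intervalIntegral.integral_of_le hab, hg]
  have hcoef : ∀ (w : ℝ × ℝ → ℂ) (x : ℝ), Continuous w →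
      Integrable (fun y => (χ n y : ℂ) * w (x, y)) (crossMeasure d) := fun w x hw => by
    have hc : Continuous fun y : ℝ => (χ n y : ℂ) * w (x, y) :=
      hχc.continuous.mul (hw.comp (by fun_prop))
    exact (hc.continuousOn.integrableOn_compact isCompact_Icc).mono_set Ioo_subset_Icc_self
  simp_rw [hsplit]
  rw [Measure.volume_eq_prod, integral_add (hint hF₁) (hint hF₂), h₁, h₂, add_zero]
  simp only [coeff]
  have e : ∀ y, ((χ n y : ℂ) *
        ((Complex.exp (τ * b) * dirDeriv (1, 0) v (b, y) -
            τ * Complex.exp (τ * b) * v (b, y)) -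
          (Complex.exp (τ * a) * dirDeriv (1, 0) v (a, y) -
            τ * Complex.exp (τ * a) * v (a, y)))) =
      (Complex.exp (τ * b) * ((χ n y : ℂ) * dirDeriv (1, 0) v (b, y)) -
        Complex.exp (τ * b) * τ * ((χ n y : ℂ) * v (b, y))) -
      (Complex.exp (τ * a) * ((χ n y : ℂ) * dirDeriv (1, 0) v (a, y)) -
        Complex.exp (τ * a) * τ * ((χ n y : ℂ) * v (a, y))) := fun y => by ring
  simp_rw [e]
  change ∫ y, _ ∂(crossMeasure d) = _
  have i1 := hcoef _ b hvx.continuous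
  have i2 := hcoef _ b hv.continuous
  have i3 := hcoef _ a hvx.continuous
  have i4 := hcoef _ a hv.continuous
  have j1 : Integrable (fun y => Complex.exp (τ * b) * ((χ n y : ℂ) * dirDeriv (1, 0) v (b, y)) -
        Complex.exp (τ * b) * τ * ((χ n y : ℂ) * v (b, y))) (crossMeasure d) :=
    (i1.const_mul _).sub (i2.const_mul _)
  have j2 : Integrable (fun y => Complex.exp (τ * a) * ((χ n y : ℂ) * dirDeriv (1, 0) v (a, y)) -
        Complex.exp (τ * a) * τ * ((χ n y : ℂ) * v (a, y))) (crossMeasure d) :=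
    (i3.const_mul _).sub (i4.const_mul _)
  rw [integral_sub j1 j2,
    integral_sub (i1.const_mul _) (i2.const_mul _), integral_sub (i3.const_mul _) (i4.const_mul _),
    integral_const_mul, integral_const_mul, integral_const_mul, integral_const_mul]
  ring

/-- The left half of a bounded piece of the waveguide. -/
def leftBox (d R : ℝ) : Set (ℝ × ℝ) := Ioo (-R) 0 ×ˢ Ioo 0 d

/-- The right half of a bounded piece of the waveguide. -/
def rightBox (d R : ℝ) : Set (ℝ × ℝ) := Ioo 0 R ×ˢ Ioo 0 d

lemma leftBox_subset_box (d : ℝ) {R : ℝ} (hR : 0 < R) : leftBox d R ⊆ box d R :=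
  prod_mono (Ioo_subset_Ioo_right hR.le) le_rfl

lemma rightBox_subset_box (d : ℝ) {R : ℝ} (hR : 0 < R) : rightBox d R ⊆ box d R :=
  prod_mono (Ioo_subset_Ioo_left (neg_nonpos.2 hR.le)) le_rfl

lemma box_subset_strip (d R : ℝ) : box d R ⊆ strip d :=
  prod_mono (subset_univ _) le_rfl

lemma dirDeriv_eq_zero {v : ℝ × ℝ → ℂ} {p : ℝ × ℝ} (hp : p ∉ tsupport v) (e : ℝ × ℝ) :
    dirDeriv e v p = 0 :=
  image_eq_zero_of_notMem_tsupport fun h => hp (tsupport_dirDeriv_subset v e h)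

/-- The Helmholtz operator `Δ + E` applied to `v`. -/
def helmholtz (E : ℝ) (v : ℝ × ℝ → ℂ) (p : ℝ × ℝ) : ℂ := lap v p + (E : ℂ) * v p

lemma continuous_helmholtz {v : ℝ × ℝ → ℂ} (hv : ContDiff ℝ ∞ v) (E : ℝ) :
    Continuous (helmholtz E v) := by
  have h : helmholtz E v = fun p => dirDeriv (1, 0) (dirDeriv (1, 0) v) p +
      dirDeriv (0, 1) (dirDeriv (0, 1) v) p + (E : ℂ) * v p :=
    funext fun p => by rw [helmholtz, lap_eq hv]
  rw [h]
  exact ((contDiff_dirDeriv (contDiff_dirDeriv hv _) _).continuous.add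
    (contDiff_dirDeriv (contDiff_dirDeriv hv _) _).continuous).add
    (continuous_const.mul hv.continuous)

lemma helmholtz_eq_zero {v : ℝ × ℝ → ℂ} (hv : ContDiff ℝ ∞ v) (E : ℝ) {p : ℝ × ℝ}
    (hp : p ∉ tsupport v) : helmholtz E v p = 0 := by
  rw [helmholtz, lap_eq hv, image_eq_zero_of_notMem_tsupport hp,
    dirDeriv_eq_zero fun h => hp (tsupport_dirDeriv_subset v _ h),
    dirDeriv_eq_zero fun h => hp (tsupport_dirDeriv_subset v _ h)]
  simp

lemma exists_tsupport_bound {v : ℝ × ℝ → ℂ} (hc : HasCompactSupport v) :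
    ∃ R : ℝ, 0 < R ∧ ∀ p : ℝ × ℝ, R ≤ |p.1| → p ∉ tsupport v := by
  obtain ⟨R, hR⟩ := hc.isCompact.isBounded.subset_closedBall 0
  refine ⟨|R| + 1, by positivity, fun p hp h => ?_⟩
  have h1 : ‖p‖ ≤ R := by simpa using hR h
  have h2 : |p.1| ≤ ‖p‖ := norm_fst_le p
  linarith [le_abs_self R]

/-! ### Matching across the interface -/

section

variable {d : ℝ} {χ : ℕ → ℝ → ℝ} {σ : ℕ → ℂ}

/-- For R beyond the support of v, only the edge x = 0 contributes. Either root τ is allowed: τ = s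
gives an outgoing wave, τ = ik the incident one. -/
lemma integral_left_mode (hd : 0 < d) (hχ : IsModeFamily d χ) (n : ℕ) {τ : ℂ} {E : ℝ}
    (hτ : τ ^ 2 = ((mu d n - E : ℝ) : ℂ)) {v : ℝ × ℝ → ℂ} (hv : ContDiff ℝ ∞ v)
    (hs : tsupport v ⊆ strip d) {R : ℝ} (hR : 0 < R)
    (hvR : ∀ p : ℝ × ℝ, R ≤ |p.1| → p ∉ tsupport v) :
    ∫ p in leftBox d R, Complex.exp (τ * p.1) * (χ n p.2 : ℂ) * helmholtz E v p =
      coeff d χ n (fun y => dirDeriv (1, 0) v (0, y)) - τ * coeff d χ n (fun y => v (0, y)) := by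
  have h := integral_mode_mul_helmholtz hd hχ n hτ hv hs (a := -R) (b := 0) (by linarith)
  have hz : ∀ y, ((-R, y) : ℝ × ℝ) ∉ tsupport v := fun y => hvR _ (by simp [abs_of_pos hR])
  have h1 : (fun y => v (-R, y)) = 0 := funext fun y => image_eq_zero_of_notMem_tsupport (hz y)
  have h2 : (fun y => dirDeriv (1, 0) v (-R, y)) = 0 := funext fun y => dirDeriv_eq_zero (hz y) _
  rw [h1, h2] at h
  refine h.trans ?_
  simp [coeff]

lemma integral_right_mode (hd : 0 < d) (hχ : IsModeFamily d χ) (n : ℕ) {τ : ℂ} {E : ℝ}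
    (hτ : τ ^ 2 = ((mu d n - E : ℝ) : ℂ)) {v : ℝ × ℝ → ℂ} (hv : ContDiff ℝ ∞ v)
    (hs : tsupport v ⊆ strip d) {R : ℝ} (hR : 0 < R)
    (hvR : ∀ p : ℝ × ℝ, R ≤ |p.1| → p ∉ tsupport v) :
    ∫ p in rightBox d R, Complex.exp (-τ * p.1) * (χ n p.2 : ℂ) * helmholtz E v p =
      -(coeff d χ n (fun y => dirDeriv (1, 0) v (0, y)) +
        τ * coeff d χ n (fun y => v (0, y))) := by
  have hτ' : (-τ) ^ 2 = ((mu d n - E : ℝ) : ℂ) := by rw [neg_sq, hτ]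
  have h := integral_mode_mul_helmholtz hd hχ n hτ' hv hs (a := 0) (b := R) (by linarith)
  have hz : ∀ y, ((R, y) : ℝ × ℝ) ∉ tsupport v := fun y => hvR _ (by simp [abs_of_pos hR])
  have h1 : (fun y => v (R, y)) = 0 := funext fun y => image_eq_zero_of_notMem_tsupport (hz y)
  have h2 : (fun y => dirDeriv (1, 0) v (R, y)) = 0 := funext fun y => dirDeriv_eq_zero (hz y) _
  rw [h1, h2] at h
  refine h.trans ?_
  simp [coeff]

lemma integral_left_modeTerm (hd : 0 < d) (hχ : IsModeFamily d χ) {E : ℝ}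
    (hσ : ∀ j, σ j ^ 2 = ((mu d (j + 1) - E : ℝ) : ℂ)) (a : ℕ → ℂ) {v : ℝ × ℝ → ℂ}
    (hv : ContDiff ℝ ∞ v) (hs : tsupport v ⊆ strip d) {R : ℝ} (hR : 0 < R)
    (hvR : ∀ p : ℝ × ℝ, R ≤ |p.1| → p ∉ tsupport v) (j : ℕ) :
    ∫ p in leftBox d R, modeTerm χ σ a j p * helmholtz E v p =
      a j * (coeff d χ (j + 1) (fun y => dirDeriv (1, 0) v (0, y)) -
        σ j * coeff d χ (j + 1) (fun y => v (0, y))) := by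
  rw [← integral_left_mode hd hχ (j + 1) (hσ j) hv hs hR hvR, ← integral_const_mul]
  refine setIntegral_congr_fun (measurableSet_Ioo.prod measurableSet_Ioo) fun p hp => ?_
  have hp1 : |p.1| = -p.1 := abs_of_neg hp.1.2
  simp only [modeTerm, hp1]
  push_cast
  rw [mul_neg, neg_neg]
  ring

lemma integral_right_modeTerm (hd : 0 < d) (hχ : IsModeFamily d χ) {E : ℝ}
    (hσ : ∀ j, σ j ^ 2 = ((mu d (j + 1) - E : ℝ) : ℂ)) (a : ℕ → ℂ) {v : ℝ × ℝ → ℂ}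
    (hv : ContDiff ℝ ∞ v) (hs : tsupport v ⊆ strip d) {R : ℝ} (hR : 0 < R)
    (hvR : ∀ p : ℝ × ℝ, R ≤ |p.1| → p ∉ tsupport v) (j : ℕ) :
    ∫ p in rightBox d R, modeTerm χ σ a j p * helmholtz E v p =
      -(a j * (coeff d χ (j + 1) (fun y => dirDeriv (1, 0) v (0, y)) +
        σ j * coeff d χ (j + 1) (fun y => v (0, y)))) := by
  rw [← mul_neg, ← integral_right_mode hd hχ (j + 1) (hσ j) hv hs hR hvR, ← integral_const_mul]
  refine setIntegral_congr_fun (measurableSet_Ioo.prod measurableSet_Ioo) fun p hp => ?_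
  have hp1 : |p.1| = p.1 := abs_of_pos hp.1.1
  simp only [modeTerm, hp1]
  rw [neg_mul]
  ring

/-- The incident wave in mode `n₀` together with the outgoing waves of amplitudes `r` on the left,
and the outgoing waves of amplitudes `t` on the right. -/
def scatteringField (d : ℝ) (n₀ : ℕ) (k : ℝ) (σ r t : ℕ → ℂ) (x y : ℝ) : ℂ :=
  if x < 0 then
    Complex.exp (Complex.I * (k : ℂ) * (x : ℂ)) * (chiMinus d n₀ y : ℂ) +
      modeField (chiMinus d) σ r (x, y)
  else modeField (chiPlus d) σ t (x, y)

lemma continuous_incident (hd : 0 < d) (n₀ : ℕ) (k : ℝ) : Continuous fun p : ℝ × ℝ =>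
    Complex.exp (Complex.I * (k : ℂ) * (p.1 : ℂ)) * (chiMinus d n₀ p.2 : ℂ) := by
  have h1 : Continuous fun p : ℝ × ℝ => (chiMinus d n₀ p.2 : ℂ) :=
    ((isModeFamily_chiMinus hd).continuous_ofReal n₀).comp continuous_snd
  have h2 : Continuous fun p : ℝ × ℝ => Complex.exp (Complex.I * (k : ℂ) * (p.1 : ℂ)) := by
    fun_prop
  exact h2.mul h1

lemma integrableOn_scatteringField (hd : 0 < d) (n₀ : ℕ) (k : ℝ) (hσ : IsDecayRate σ)
    (r t : lp (fun _ : ℕ => ℂ) 2) (R : ℝ) :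
    IntegrableOn (fun p : ℝ × ℝ => scatteringField d n₀ k σ r t p.1 p.2) (box d R) := by
  classical
  have hM := integrableOn_modeField (isModeFamily_chiMinus hd) hd hσ r R
  have hP := integrableOn_modeField (isModeFamily_chiPlus hd) hd hσ t R
  have hI := integrableOn_box (continuous_incident hd n₀ k) d R
  have hs : MeasurableSet {p : ℝ × ℝ | p.1 < 0} :=
    measurableSet_lt measurable_fst measurable_const
  exact Integrable.piecewise hs (hI.add hM).integrableOn hP.integrableOn

lemma locallyIntegrableOn_scatteringField (hd : 0 < d) (n₀ : ℕ) (k : ℝ) (hσ : IsDecayRate σ)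
    (r t : lp (fun _ : ℕ => ℂ) 2) :
    LocallyIntegrableOn (fun p : ℝ × ℝ => scatteringField d n₀ k σ r t p.1 p.2) (strip d)
      volume := by
  intro p hp
  refine ⟨box d (|p.1| + 1), mem_nhdsWithin_of_mem_nhds ?_,
    integrableOn_scatteringField hd n₀ k hσ r t _⟩
  refine (isOpen_Ioo.prod isOpen_Ioo).mem_nhds ⟨abs_lt.1 (by linarith), hp.2⟩

/-- If the amplitudes come from a solution of `D φ = -2ik χ⁻_{n₀}`, the field solves the Helmholtz
equation across the interface. -/
lemma integral_scatteringField_mul_helmholtz (hd : 0 < d) {n₀ : ℕ} (hn₀ : 1 ≤ n₀) {k : ℝ}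
    (hk : 0 < k) (hthr : ∀ n : ℕ, 1 ≤ n → mu d n₀ + k ^ 2 ≠ mu d n) {φ : ℝ → ℂ}
    {a t r : lp (fun _ : ℕ => ℂ) 2}
    (ha : φ =ᵐ[crossMeasure d] (isModeFamily_chiMinus hd).synth a)
    (ht : φ =ᵐ[crossMeasure d] (isModeFamily_chiPlus hd).synth t)
    (hr : ∀ j, r j = a j - if j = n₀ - 1 then 1 else 0)
    (hD : DEqMode d n₀ k φ (-2 * Complex.I * (k : ℂ)) n₀) {v : ℝ × ℝ → ℂ} (hv : ContDiff ℝ ∞ v)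
    (hc : HasCompactSupport v) (hs : tsupport v ⊆ strip d) :
    ∫ p in strip d, scatteringField d n₀ k (fun j => symbolD d n₀ k (j + 1)) r t p.1 p.2 *
      helmholtz (mu d n₀ + k ^ 2) v p = 0 := by
  set σ : ℕ → ℂ := fun j => symbolD d n₀ k (j + 1) with hσdef
  set E : ℝ := mu d n₀ + k ^ 2 with hE
  have hM := isModeFamily_chiMinus hd
  have hP := isModeFamily_chiPlus hd
  have hσ : IsDecayRate σ := isDecayRate_symbolD hd n₀ k hthr
  have hσsq : ∀ j, σ j ^ 2 = ((mu d (j + 1) - E : ℝ) : ℂ) := fun j =>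
    symbolD_sq hd n₀ k (Nat.le_add_left 1 j)
  have hmm : n₀ - 1 + 1 = n₀ := Nat.sub_add_cancel hn₀
  have hσm : σ (n₀ - 1) = -Complex.I * k := by
    rw [hσdef]
    simp only [hmm]
    exact symbolD_self hd hn₀ hk
  obtain ⟨R, hR, hvR⟩ := exists_tsupport_bound hc
  set G := helmholtz E v with hG
  have hGc : Continuous G := continuous_helmholtz hv E
  obtain ⟨C, hC⟩ := hGc.bounded_above_of_compact_support
    (HasCompactSupport.intro hc.isCompact fun p hp => helmholtz_eq_zero hv E hp)
  set f : ℝ × ℝ → ℂ := fun p => scatteringField d n₀ k σ r t p.1 p.2 with hf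
  have hfG : IntegrableOn (fun p => f p * G p) (box d R) :=
    (integrableOn_scatteringField hd n₀ k hσ r t R).mul_bdd (c := C)
      hGc.aestronglyMeasurable (Eventually.of_forall hC)
  have hsub : leftBox d R ∪ rightBox d R ⊆ strip d :=
    (union_subset (leftBox_subset_box d hR) (rightBox_subset_box d hR)).trans
      (box_subset_strip d R)
  have hae : ∀ᵐ p ∂(volume : Measure (ℝ × ℝ)), p.1 ≠ 0 := by
    simpa using ae_fst_ne_zero univ
  have hsplit : ∫ p in strip d, f p * G p =
      (∫ p in leftBox d R, f p * G p) + ∫ p in rightBox d R, f p * G p := by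
    have hms : MeasurableSet (strip d) := MeasurableSet.univ.prod measurableSet_Ioo
    rw [setIntegral_eq_of_subset_of_ae_sdiff_eq_zero hms.nullMeasurableSet hsub, setIntegral_union]
    · refine Set.disjoint_left.2 fun p hp hp' => ?_
      exact lt_asymm hp.1.2 hp'.1.1
    · exact measurableSet_Ioo.prod measurableSet_Ioo
    · exact hfG.mono_set (leftBox_subset_box d hR)
    · exact hfG.mono_set (rightBox_subset_box d hR)
    · filter_upwards [hae] with p hp0 hp
      have hR' : R ≤ |p.1| := by
        by_contra! hlt
        have h2 := abs_lt.1 hlt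
        rcases lt_or_gt_of_ne hp0 with h | h
        · exact hp.2 (Or.inl ⟨⟨h2.1, h⟩, hp.1.2⟩)
        · exact hp.2 (Or.inr ⟨⟨h, h2.2⟩, hp.1.2⟩)
      rw [hG, helmholtz_eq_zero hv E (hvR p hR'), mul_zero]
  set A := fun j => coeff d (chiMinus d) (j + 1) (fun y => dirDeriv (1, 0) v (0, y)) with hA
  set P := fun j => coeff d (chiMinus d) (j + 1) (fun y => v (0, y)) with hPdef
  set B := fun j => coeff d (chiPlus d) (j + 1) (fun y => dirDeriv (1, 0) v (0, y)) with hB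
  set Q := fun j => coeff d (chiPlus d) (j + 1) (fun y => v (0, y)) with hQ
  have hleft : HasSum (fun j => r j * (A j - σ j * P j))
      (∫ p in leftBox d R, modeField (chiMinus d) σ r p * G p) :=
    (hasSum_integral_modeField hM hd hσ r R (leftBox_subset_box d hR) hGc hC).congr_fun fun j =>
      (integral_left_modeTerm hd hM hσsq r hv hs hR hvR j).symm
  have hright : HasSum (fun j => -(t j * (B j + σ j * Q j)))
      (∫ p in rightBox d R, modeField (chiPlus d) σ t p * G p) :=
    (hasSum_integral_modeField hP hd hσ t R (rightBox_subset_box d hR) hGc hC).congr_fun fun j =>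
      (integral_right_modeTerm hd hP hσsq t hv hs hR hvR j).symm
  have hinc : ∫ p in leftBox d R, Complex.exp (Complex.I * (k : ℂ) * (p.1 : ℂ)) *
      (chiMinus d n₀ p.2 : ℂ) * G p =
        A (n₀ - 1) - Complex.I * k * P (n₀ - 1) := by
    have hτ : (Complex.I * (k : ℂ)) ^ 2 = ((mu d n₀ - E : ℝ) : ℂ) := by
      rw [hE, mul_pow, Complex.I_sq]
      push_cast
      ring
    simp only [hA, hPdef, hmm]
    exact integral_left_mode hd hM n₀ hτ hv hs hR hvR
  have hL : ∫ p in leftBox d R, f p * G p = (A (n₀ - 1) - Complex.I * k * P (n₀ - 1)) +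
      ∫ p in leftBox d R, modeField (chiMinus d) σ r p * G p := by
    rw [← hinc, ← integral_add]
    · refine setIntegral_congr_fun (measurableSet_Ioo.prod measurableSet_Ioo) fun p hp => ?_
      simp only [hf, scatteringField, if_pos hp.1.2]
      ring
    · exact (integrableOn_box ((continuous_incident hd n₀ k).mul hGc) d R).mono_set
        (leftBox_subset_box d hR)
    · exact ((integrableOn_modeField hM hd hσ r R).mul_bdd (c := C)
        hGc.aestronglyMeasurable (Eventually.of_forall hC)).mono_measure
          (Measure.restrict_mono_set _ (leftBox_subset_box d hR))
  have hRt : ∫ p in rightBox d R, f p * G p =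
      ∫ p in rightBox d R, modeField (chiPlus d) σ t p * G p := by
    refine setIntegral_congr_fun (measurableSet_Ioo.prod measurableSet_Ioo) fun p hp => ?_
    simp only [hf, scatteringField, if_neg hp.1.1.not_gt]
  have htest := isCrossTest_slice hv hs 0
  have htest' := isCrossTest_slice (contDiff_dirDeriv hv (1, 0))
    ((tsupport_dirDeriv_subset v (1, 0)).trans hs) 0
  have hLp := (htest'.memHHalf hd).1.1
  have sA := hasSum_mul_coeff hM ha hLp
  have sB := hasSum_mul_coeff hP ht hLp
  -- The bracket for D is antilinear in φ, whereas the integrals here are bilinear. Testing with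
  -- conj v(0,·) and conjugating the identity reconciles the two.
  have hconj : IsCrossTest d fun y => conj (v (0, y)) :=
    ⟨Complex.conjCLE.contDiff.comp htest.contDiff,
      (closure_mono fun y hy => by
        refine Function.mem_support.2 fun h => hy ?_
        simp only [h, map_zero]).trans htest.tsupport_subset⟩
  have hcc : ∀ (χ : ℕ → ℝ → ℝ) (n : ℕ), coeff d χ n (fun y => conj (v (0, y))) =
      conj (coeff d χ n fun y => v (0, y)) := fun χ n => by
    rw [coeff, coeff, ← integral_conj]
    simp
  have sD := hD _ (hconj.memHHalf hd)
  simp_rw [hcc, hM.coeff_of_ae_eq_synth ha, hP.coeff_of_ae_eq_synth ht] at sD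
  have sD' : HasSum (fun j => σ j * a j * P j + σ j * t j * Q j)
      (-2 * Complex.I * k * P (n₀ - 1)) := by
    have h := sD.map (starRingEnd ℂ) Complex.continuous_conj
    simp only [Function.comp_def, map_add, map_mul, Complex.conj_conj] at h
    simp only [hPdef, hmm]
    exact h
  -- Restores the χ^-_{n₀} component removed from a to form r, so that full coefficients of φ appear
  -- in the sums.
  have sδ : HasSum (fun j => if j = n₀ - 1 then A (n₀ - 1) - σ (n₀ - 1) * P (n₀ - 1) else 0)
      (A (n₀ - 1) - σ (n₀ - 1) * P (n₀ - 1)) := hasSum_ite_eq _ _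
  -- The A and B sums both equal ∫ φ ∂_x v(0,·) and cancel; the P and Q sums form the tested
  -- equation, contributing 2ikP. The incident integral minus the δ term contributes (A - ikP) - (A
  -- + ikP) = -2ikP, because s_{n₀} = -ik.
  have htot := ((hleft.add hright).add sδ).unique
    (((sA.sub sB).sub sD').congr_fun fun j => by
      rw [hr]
      by_cases hj : j = n₀ - 1
      · subst hj
        simp only [if_pos]
        ring
      · simp only [if_neg hj]
        ring)
  rw [hsplit, hL, hRt]
  rw [hσm] at htot
  linear_combination htot

end

/-! ### Mode expansion and boundary values of the scattering field -/

lemma IsModeFamily.synth_single {d : ℝ} {χ : ℕ → ℝ → ℝ} (h : IsModeFamily d χ) (i : ℕ) :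
    h.synth (lp.single 2 i 1) = h.modeLp i := by
  rw [IsModeFamily.synth, OrthogonalFamily.linearIsometry_apply_single,
    LinearIsometry.toSpanSingleton_apply, one_smul]

lemma aestronglyMeasurable_modeField {d : ℝ} {χ : ℕ → ℝ → ℝ} {σ : ℕ → ℂ} (hχ : IsModeFamily d χ)
    (hσ : IsDecayRate σ) (a : lp (fun _ : ℕ => ℂ) 2) {x : ℝ} (hx : x ≠ 0) :
    AEStronglyMeasurable (fun y => modeField χ σ a (x, y)) (crossMeasure d) := by
  refine aestronglyMeasurable_of_tendsto_ae atTop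
    (f := fun (N : ℕ) y => ∑ j ∈ Finset.range N, modeTerm χ σ a j (x, y)) (fun N => ?_)
    (Eventually.of_forall fun y => (hasSum_modeField hχ hσ a (p := (x, y)) hx).tendsto_sum_nat)
  refine Continuous.aestronglyMeasurable (continuous_finsetSum _ fun j _ => ?_)
  exact (continuous_modeTerm hχ σ a j).comp (by fun_prop)

/-- The field is one series over all modes; removing its first n₁ terms leaves the evanescent tail,
as the symbol changes branch exactly there. -/
lemma hasModeExpansion_scatteringField {d : ℝ} (hd : 0 < d) (n₀ : ℕ) (k : ℝ)
    (hσ : IsDecayRate fun j => symbolD d n₀ k (j + 1)) (r t : lp (fun _ : ℕ => ℂ) 2) :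
    HasModeExpansion d n₀ k (fun n => if n = 0 then 0 else r (n - 1))
      (fun n => if n = 0 then 0 else t (n - 1))
      (scatteringField d n₀ k (fun j => symbolD d n₀ k (j + 1)) r t) := by
  set N := topMode d n₀ k with hN
  have hidx : ∀ j : ℕ, N + 1 + j = j + N + 1 := fun j => by omega
  have hev : ∀ j : ℕ, symbolD d n₀ k (j + N + 1) = kappaMode d n₀ k (j + N + 1) := fun j => by
    rw [symbolD, if_neg (by omega)]
  have hpr : ∀ l : ℕ, l ∈ Finset.range N →
      symbolD d n₀ k (l + 1) = -Complex.I * kMode d n₀ k (l + 1) := fun l hl => by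
    rw [symbolD, if_pos (by have := Finset.mem_range.1 hl; omega)]
  constructor
  · intro x hx y _
    have h := (hasSum_nat_add_iff' N).2
      (hasSum_modeField (isModeFamily_chiMinus hd) hσ r (p := (x, y)) hx.ne)
    convert! h using 1
    · funext j
      rw [← hN, hidx, modeTerm, hev]
      simp only [Nat.add_eq_zero_iff, one_ne_zero, and_false, if_false, Nat.add_sub_cancel,
        abs_of_neg hx]
      push_cast
      rw [mul_neg, neg_neg]
    · rw [scatteringField, if_pos hx, IsModeFamily.sum_Icc_eq_sum_range, add_sub_add_left_eq_sub]
      congr 1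
      refine Finset.sum_congr rfl fun l hl => ?_
      rw [modeTerm, hpr l hl]
      simp only [Nat.add_eq_zero_iff, one_ne_zero, and_false, if_false, Nat.add_sub_cancel,
        abs_of_neg hx]
      push_cast
      rw [mul_neg, neg_neg]
  · intro x hx y _
    have h := (hasSum_nat_add_iff' N).2
      (hasSum_modeField (isModeFamily_chiPlus hd) hσ t (p := (x, y)) hx.ne')
    convert! h using 1
    · funext j
      rw [← hN, hidx, modeTerm, hev]
      simp only [Nat.add_eq_zero_iff, one_ne_zero, and_false, if_false, Nat.add_sub_cancel,
        abs_of_pos hx, neg_mul]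
    · rw [scatteringField, if_neg hx.not_gt, IsModeFamily.sum_Icc_eq_sum_range]
      congr 1
      refine Finset.sum_congr rfl fun l hl => ?_
      rw [modeTerm, hpr l hl]
      simp only [Nat.add_eq_zero_iff, one_ne_zero, and_false, if_false, Nat.add_sub_cancel,
        abs_of_pos hx, neg_mul, neg_neg]

/-- The incident wave tends to χ^-_{n₀} and the outgoing part to φ - χ^-_{n₀}; the triangle
inequality adds the two limits. -/
lemma tendsto_scatteringField_left {d : ℝ} (hd : 0 < d) (n₀ : ℕ) (k : ℝ) {σ : ℕ → ℂ}
    (hσ : IsDecayRate σ) (r t : lp (fun _ : ℕ => ℂ) 2) {φ : ℝ → ℂ}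
    (hφ : MemLp φ 2 (crossMeasure d))
    (hr : (fun y => φ y - (chiMinus d n₀ y : ℂ)) =ᵐ[crossMeasure d]
      (isModeFamily_chiMinus hd).synth r) :
    Tendsto (fun x : ℝ => eLpNorm (fun y => scatteringField d n₀ k σ r t x y - φ y) 2
      (crossMeasure d)) (𝓝[<] 0) (𝓝 0) := by
  have hM := isModeFamily_chiMinus hd
  have h1 := (tendsto_modeField hM hσ r hr).mono_left
    (nhdsWithin_mono (0 : ℝ) (fun x (hx : x < 0) => hx.ne : Iio (0 : ℝ) ⊆ {0}ᶜ))
  have h2 : Tendsto (fun x : ℝ => ‖Complex.exp (Complex.I * (k : ℂ) * (x : ℂ)) - 1‖ₑ *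
      eLpNorm (fun y => (chiMinus d n₀ y : ℂ)) 2 (crossMeasure d)) (𝓝[<] 0) (𝓝 0) := by
    have hc : Continuous fun x : ℝ => ‖Complex.exp (Complex.I * (k : ℂ) * (x : ℂ)) - 1‖ₑ := by
      fun_prop
    have h0 := hc.tendsto 0
    simp only [Complex.ofReal_zero, mul_zero, Complex.exp_zero, sub_self, enorm_zero] at h0
    have h3 := ENNReal.Tendsto.mul_const h0 (Or.inr (hM.memLp n₀).eLpNorm_ne_top)
    rw [zero_mul] at h3
    exact h3.mono_left nhdsWithin_le_nhds
  have h3 := h2.add h1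
  rw [add_zero] at h3
  refine tendsto_of_tendsto_of_tendsto_of_le_of_le' tendsto_const_nhds h3
    (Eventually.of_forall fun _ => zero_le) ?_
  filter_upwards [self_mem_nhdsWithin] with x hx
  have hx' : x < 0 := hx
  rw [← eLpNorm_const_smul]
  have hmeas : AEStronglyMeasurable
      (fun y => modeField (chiMinus d) σ r (x, y) - (φ y - (chiMinus d n₀ y : ℂ)))
      (crossMeasure d) :=
    (aestronglyMeasurable_modeField hM hσ r hx'.ne).sub
      (hφ.aestronglyMeasurable.sub (hM.memLp n₀).aestronglyMeasurable)
  refine le_trans (le_of_eq ?_) (eLpNorm_add_le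
    ((hM.memLp n₀).aestronglyMeasurable.const_smul _) hmeas one_le_two)
  congr 1
  funext y
  simp only [scatteringField, if_pos hx', Pi.add_apply, Pi.smul_apply, smul_eq_mul]
  ring

lemma tendsto_scatteringField_right {d : ℝ} (hd : 0 < d) (n₀ : ℕ) (k : ℝ) {σ : ℕ → ℂ}
    (hσ : IsDecayRate σ) (r t : lp (fun _ : ℕ => ℂ) 2) {φ : ℝ → ℂ}
    (ht : φ =ᵐ[crossMeasure d] (isModeFamily_chiPlus hd).synth t) :
    Tendsto (fun x : ℝ => eLpNorm (fun y => scatteringField d n₀ k σ r t x y - φ y) 2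
      (crossMeasure d)) (𝓝[>] 0) (𝓝 0) := by
  refine ((tendsto_modeField (isModeFamily_chiPlus hd) hσ t ht).mono_left
    (nhdsWithin_mono (0 : ℝ) (fun x (hx : 0 < x) => hx.ne' : Ioi (0 : ℝ) ⊆ {0}ᶜ))).congr' ?_
  filter_upwards [self_mem_nhdsWithin] with x hx
  have hx' : ¬ x < 0 := (mem_Ioi.1 hx).not_gt
  simp only [scatteringField, if_neg hx']

lemma summable_shifted_coeffs {a : ℕ → ℂ} (h : Summable fun j : ℕ => ((j : ℝ) + 1) * ‖a j‖ ^ 2) :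
    Summable fun n : ℕ => (n : ℝ) * ‖(if n = 0 then 0 else a (n - 1) : ℂ)‖ ^ 2 := by
  rw [← summable_nat_add_iff 1]
  refine h.congr fun j => ?_
  simp

end Waveguide

end

theorem mainTheorem1 (d : ℝ) (hd : 0 < d) (n₀ : ℕ) (hn₀ : 1 ≤ n₀) (k E : ℝ) (hk : 0 < k)
    (hE : E = mu d n₀ + k ^ 2) (hthr : ∀ n : ℕ, 1 ≤ n → E ≠ mu d n) :
    ∃ (f : ℝ → ℝ → ℂ) (r t : ℕ → ℂ) (φ : ℝ → ℂ),
      -- `f` belongs to the class of scattering functions with energy `E` and incident mode `n₀`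
      HasModeExpansion d n₀ k r t f ∧
      Summable (fun n : ℕ => (n : ℝ) * ‖r n‖ ^ 2) ∧
      Summable (fun n : ℕ => (n : ℝ) * ‖t n‖ ^ 2) ∧
      -- `(Δ + E) f = 0` in the sense of distributions in the whole strip
      IsDistribSolution d E f ∧
      -- `φ` is the common trace of `f` at `x = 0`, from the left and from the right
      MemHHalf d φ ∧
      Tendsto (fun x : ℝ => eLpNorm (fun y => f x y - φ y) 2 (crossMeasure d)) (𝓝[<] 0) (𝓝 0) ∧
      Tendsto (fun x : ℝ => eLpNorm (fun y => f x y - φ y) 2 (crossMeasure d)) (𝓝[>] 0) (𝓝 0) ∧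
      DEqMode d n₀ k φ (-2 * Complex.I * (k : ℂ)) n₀ := by
  subst hE
  have hM := isModeFamily_chiMinus hd
  have hP := isModeFamily_chiPlus hd
  have hσ := isDecayRate_symbolD hd n₀ k hthr
  obtain ⟨φ, hφ, hD⟩ := exists_DEqMode hd n₀ k hthr (-2 * Complex.I * (k : ℂ)) hn₀
  obtain ⟨a, ha, hsa⟩ := hM.exists_synth_of_memSobolev hφ.1
  obtain ⟨t, ht, hst⟩ := hP.exists_synth_of_memSobolev hφ.2
  -- The left trace is the incident mode plus the reflected field, so continuity forces r = a - δ at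
  -- coordinate n₀ - 1. Changing one coordinate does not affect summability.
  let r : lp (fun _ : ℕ => ℂ) 2 := a - lp.single 2 (n₀ - 1) 1
  have hr : ∀ j, r j = a j - if j = n₀ - 1 then 1 else 0 := fun j => by
    show a j - (lp.single 2 (n₀ - 1) 1 : lp (fun _ : ℕ => ℂ) 2) j = _
    rw [lp.single_apply, Pi.single_apply]
  have hsr : Summable fun j : ℕ => ((j : ℝ) + 1) * ‖r j‖ ^ 2 := by
    refine hsa.congr_cofinite ?_
    have hfin : ∀ᶠ j : ℕ in cofinite, j ≠ n₀ - 1 := by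
      rw [eventually_cofinite]
      simp
    filter_upwards [hfin] with j hj
    rw [hr, if_neg hj, sub_zero]
  have hrφ : (fun y => φ y - (chiMinus d n₀ y : ℂ)) =ᵐ[crossMeasure d] hM.synth r := by
    have h1 : hM.synth r = hM.synth a - hM.modeLp (n₀ - 1) := by
      rw [map_sub, hM.synth_single]
    rw [h1]
    filter_upwards [Lp.coeFn_sub (hM.synth a) (hM.modeLp (n₀ - 1)), ha,
      (hM.memLp (n₀ - 1 + 1)).coeFn_toLp] with y e1 e2 e3
    rw [e1, Pi.sub_apply, ← e2, IsModeFamily.modeLp, e3, Nat.sub_add_cancel hn₀]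
  exact ⟨_, _, _, φ, hasModeExpansion_scatteringField hd n₀ k hσ r t, summable_shifted_coeffs hsr,
    summable_shifted_coeffs hst,
    ⟨locallyIntegrableOn_scatteringField hd n₀ k hσ r t, fun v hv hc hs =>
      integral_scatteringField_mul_helmholtz hd hn₀ hk hthr ha ht hr hD hv hc hs⟩,
    hφ, tendsto_scatteringField_left hd n₀ k hσ r t hφ.1.1 hrφ,
    tendsto_scatteringField_right hd n₀ k hσ r t ht, hD⟩
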